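/- Consider a network with finitely many tiers of base stations (BSs) in the plane. The BSs of tier $i$ form a homogeneous Poisson point process $\Phi_i$ of intensity $\lambda_i>0$, the processes of different tiers being independent; they have transmission power $P_i>0$, bias factor $B_i>0$ and antenna height $h_i$. The user is above the origin at height $h_{\mathrm u}$; put $h_{\mathrm ui}=|h_{\mathrm u}-h_i|$. The path loss exponent is $\eta>2$, so the biased power received at horizontal position $v\in\mathbb R^2$ (at height $h_{\mathrm u}$) from a tier-$i$ BS at horizontal position $z$ is $B_iP_i\,(|v-z|^2+h_{\mathrm ui}^2)^{-\eta/2}$. The user is served by the BS whose biased power received at $\mathbf 0$ is the highest; $n$ denotes the tier of the serving BS and $X$ the horizontal distance from the user to it. Let $\beta_{kj}=\left(\frac{B_kP_k}{B_jP_j}\right)^{2/\eta}$. Fix tiers $k,j$ (possibly equal). On the event $n=k$, with serving BS at $p$, let $z$ be the tier-$j$ BS other than the serving one with the highest biased power received at $\mathbf 0$, let $$\mathcal T_{kj}=\left\{v\in\mathbb R^2:\ \frac{B_kP_k}{(|v-p|^2+h_{\mathrm uk}^2)^{\eta/2}}=\frac{B_jP_j}{(|v-z|^2+h_{\mathrm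 uj}^2)^{\eta/2}}\right\}$$ be the $kj$ cell boundary, and for $\Delta d>0$ let $\mathcal T_{kj}^{(\Delta d)}=\{u:\exists v\in\mathcal T_{kj},\ |u-v|<\Delta d\}$ be the $\Delta d$-extended boundary. Then the event $n=k$ has positive probability, and for almost every $r_k$ (with respect to the law of $X$ given $n=k$) with $\frac{r_k^2+h_{\mathrm uk}^2}{\beta_{kj}}-h_{\mathrm uj}^2\ge 0$ (which always holds for $k=j$), $$\mathbb P\big[\mathbf 0\in\mathcal T_{kj}^{(\Delta d)}\,\big|\,X=r_k,\ n=k\big]=2\lambda_j\,\Delta d\,\vartheta_{kj}(r_k)+O(\Delta d^2)\qquad(\Delta d\to0^+),$$ where the conditional probabilities for all $\Delta d>0$ are taken from one regular conditional distribution given $X$ (of the distance from $\mathbf 0$ to $\mathcal T_{kj}$), the constant in $O$ may depend on $r_k$ and the network, and $$\vartheta_{kj}(r)=\frac1{\beta_{kj}}\int_0^\pi\sqrt{r^2(\beta_{kj}+1)+h_{\mathrm uk}^2\beta_{kj}-h_{\mathrm uj}^2\beta_{kj}^2-2\beta_{kj}\,r\cos\theta\,\sqrt{\tfrac{r^2+h_{\mathrm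 uk}^2}{\beta_{kj}}-h_{\mathrm uj}^2}}\;d\theta\quad\text{for }k\ne j,$$ $$\vartheta_{kk}(r)=r\int_0^\pi\sqrt{2-2\cos\theta}\,d\theta=4r\quad\text{for }k=j.$$ -/

import Mathlib

open MeasureTheory ProbabilityTheory Filter Asymptotics Topology
open scoped NNReal ENNReal

namespace Cellular

/-- The horizontal plane. All heights are kept as separate parameters. -/
abbrev Plane : Type := EuclideanSpace ℝ (Fin 2)

/-- Locally finite configurations of points in the plane. -/
def Config : Type :=
  {S : Set Plane // ∀ B : Set Plane, Bornology.IsBounded B → (S ∩ B).Finite}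

/-- The number of points of a configuration in a region (used for bounded regions). -/
noncomputable def Config.count (B : Set Plane) (S : Config) : ℕ := (S.1 ∩ B).ncard

/-- The usual σ-algebra on configurations, generated by the counts in bounded Borel sets. -/
noncomputable instance Config.instMeasurableSpace : MeasurableSpace Config :=
  ⨆ (B : Set Plane) (_ : MeasurableSet B) (_ : Bornology.IsBounded B),
    MeasurableSpace.comap (Config.count B) ⊤

/-- `Φ` is a homogeneous Poisson point process of intensity `lam` on the plane: the number of
points in a bounded Borel set `B` is Poisson with mean `lam * area B`, and the numbers of points
in disjoint bounded Borel sets are independent. -/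
structure IsPoissonProcess {Ω : Type*} [MeasurableSpace Ω] (Φ : Ω → Config) (lam : ℝ)
    (μ : Measure Ω) : Prop where
  measurable : Measurable Φ
  law : ∀ B : Set Plane, MeasurableSet B → Bornology.IsBounded B →
    μ.map (fun ω => (Φ ω).count B) = poissonMeasure (lam * (volume B).toReal).toNNReal
  indep : ∀ (n : ℕ) (B : Fin n → Set Plane), (∀ i, MeasurableSet (B i)) →
    (∀ i, Bornology.IsBounded (B i)) → Pairwise (fun i i' => Disjoint (B i) (B i')) →
    iIndepFun (fun i ω => (Φ ω).count (B i)) μ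

/-- The parameters of a multi-tier network with set of tiers `ι`. -/
structure Network (ι : Type*) where
  /-- intensity of the base stations of each tier -/
  lam : ι → ℝ
  /-- transmission power of each tier -/
  power : ι → ℝ
  /-- bias factor of each tier -/
  bias : ι → ℝ
  /-- antenna height of each tier -/
  height : ι → ℝ
  /-- height of the user -/
  userHeight : ℝ
  /-- path loss exponent -/
  η : ℝ
  lam_pos : ∀ i, 0 < lam i
  power_pos : ∀ i, 0 < power i
  bias_pos : ∀ i, 0 < bias i
  two_lt_η : 2 < η

namespace Network

variable {ι : Type*} (N : Network ι)

/-- The height difference `h_{uk}` between the user and the base stations of tier `k`. -/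
def heightDiff (k : ι) : ℝ := |N.userHeight - N.height k|

/-- `β_{kj} = (B_k P_k / (B_j P_j)) ^ (2 / η)`. -/
noncomputable def beta (k j : ι) : ℝ :=
  ((N.bias k * N.power k) / (N.bias j * N.power j)) ^ (2 / N.η)

/-- The biased power received at horizontal position `v` (at the height of the user) from a tier `k`
base station at horizontal position `z`; it is infinite at distance zero. -/
noncomputable def rss (k : ι) (z v : Plane) : ℝ≥0∞ :=
  ENNReal.ofReal (N.bias k * N.power k) /
    ENNReal.ofReal ((‖v - z‖ ^ 2 + N.heightDiff k ^ 2) ^ (N.η / 2))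

/-- The user at the origin is served by the tier `k` base station at `p`: that station gives a
higher biased received power than every other station. -/
def IsServing (φ : ι → Config) (k : ι) (p : Plane) : Prop :=
  p ∈ (φ k).1 ∧ ∀ i, ∀ z ∈ (φ i).1, ¬ (i = k ∧ z = p) → N.rss i z 0 < N.rss k p 0

/-- The user at the origin is associated with tier `k` (the event `n = k`). -/
def IsAssociated (φ : ι → Config) (k : ι) : Prop := ∃ p, N.IsServing φ k p

/-- The horizontal distance `X` from the user at the origin to its serving tier `k` base station
(there is at most one; the value is `0` if the user is not associated with tier `k`). -/
noncomputable def serviceDist (φ : ι → Config) (k : ι) : ℝ :=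
  Metric.infDist 0 {p | N.IsServing φ k p}

/-- Given the tier `k` base station at `p`, `z` is a neighbouring tier `j` base station (different
from it) with the best biased received power at the origin among all those stations. -/
def IsBestNeighbour (φ : ι → Config) (k j : ι) (p z : Plane) : Prop :=
  z ∈ (φ j).1 ∧ ¬ (j = k ∧ z = p) ∧
    ∀ z' ∈ (φ j).1, ¬ (j = k ∧ z' = p) → N.rss j z' 0 ≤ N.rss j z 0

/-- The `kj` cell boundary `T_{kj}`: the points at which the biased received power from the serving
tier `k` base station equals that from the best neighbouring tier `j` base station. -/
def boundary (φ : ι → Config) (k j : ι) : Set Plane :=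
  {v | ∃ p z, N.IsServing φ k p ∧ N.IsBestNeighbour φ k j p z ∧ N.rss k p v = N.rss j z v}

/-- The `d`-extended cell boundary. -/
def extendedBoundary (φ : ι → Config) (k j : ι) (d : ℝ) : Set Plane :=
  {u | ∃ v ∈ N.boundary φ k j, ‖u - v‖ < d}

/-- The distance from the origin to the `kj` cell boundary (`∞` if it is empty). -/
noncomputable def boundaryDist (φ : ι → Config) (k j : ι) : ℝ≥0∞ :=
  Metric.infEDist 0 (N.boundary φ k j)

/-- The origin is on the `d`-extended boundary iff its distance to the boundary is below `d`. -/
theorem zero_mem_extendedBoundary_iff (φ : ι → Config) (k j : ι) (d : ℝ) :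
    (0 : Plane) ∈ N.extendedBoundary φ k j d ↔ N.boundaryDist φ k j < ENNReal.ofReal d := by
  unfold extendedBoundary boundaryDist
  rw [Metric.infEDist_lt_iff]
  refine exists_congr fun v => and_congr_right fun _ => ?_
  rw [← dist_eq_norm, edist_dist]
  exact (ENNReal.ofReal_lt_ofReal_iff_of_nonneg dist_nonneg).symm

variable {Ω : Type*} [MeasurableSpace Ω] (Φ : ι → Ω → Config) (μ : Measure Ω)

/-- The probability law conditioned on the event `n = k`. -/
noncomputable def assocMeasure (k : ι) : Measure Ω :=
  ProbabilityTheory.cond μ {ω | N.IsAssociated (fun i => Φ i ω) k}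

instance [IsFiniteMeasure μ] (k : ι) : IsFiniteMeasure (N.assocMeasure Φ μ k) := by
  unfold assocMeasure
  infer_instance

/-- The conditional probability `P[0 ∈ T_{kj}^{(d)} | X = r, n = k]`, through the regular conditional
distribution of the distance from `0` to `T_{kj}` given `X`, under the law given `n = k`;
the event that the distance is below `d` is the event `0 ∈ T_{kj}^{(d)}`. -/
noncomputable def condProb [IsFiniteMeasure μ] (k j : ι) (r d : ℝ) : ℝ :=
  (condDistrib (fun ω => N.boundaryDist (fun i => Φ i ω) k j)
    (fun ω => N.serviceDist (fun i => Φ i ω) k) (N.assocMeasure Φ μ k) r).real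
    (Set.Iio (ENNReal.ofReal d))

open scoped Classical in
/-- The function `ϑ`. -/
noncomputable def vartheta (k j : ι) (r : ℝ) : ℝ :=
  if k = j then r * ∫ θ in (0 : ℝ)..Real.pi, Real.sqrt (2 - 2 * Real.cos θ)
  else
    1 / N.beta k j * ∫ θ in (0 : ℝ)..Real.pi,
      Real.sqrt (r ^ 2 * (N.beta k j + 1) + N.heightDiff k ^ 2 * N.beta k j
        - N.heightDiff j ^ 2 * N.beta k j ^ 2
        - 2 * N.beta k j * r * Real.cos θ *
          Real.sqrt ((r ^ 2 + N.heightDiff k ^ 2) / N.beta k j - N.heightDiff j ^ 2))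

end Network

end Cellular

namespace Cellular

namespace Config

theorem measurable_count {B : Set Plane} (hB : MeasurableSet B) (hb : Bornology.IsBounded B) :
    Measurable (count B) := by
  refine Measurable.mono (comap_measurable (count B)) ?_ le_rfl
  exact le_iSup₂_of_le B hB (le_iSup_of_le hb le_rfl)

theorem countable_coe (φ : Config) : φ.1.Countable := by
  have h : φ.1 = ⋃ n : ℕ, φ.1 ∩ Metric.ball 0 n := by
    rw [← Set.inter_iUnion, Metric.iUnion_ball_nat, Set.inter_univ]
  rw [h]
  exact Set.countable_iUnion fun n => (φ.2 _ Metric.isBounded_ball).countable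

theorem measurableSet_coe (φ : Config) : MeasurableSet φ.1 := φ.countable_coe.measurableSet

/-- The counting measure of a configuration. -/
noncomputable def pointMeasure (φ : Config) : Measure Plane := Measure.count.restrict φ.1

theorem pointMeasure_apply (φ : Config) {B : Set Plane} (hB : MeasurableSet B) :
    φ.pointMeasure B = ((φ.1 ∩ B).encard : ℝ≥0∞) := by
  rw [pointMeasure, Measure.restrict_apply hB,
    Measure.count_apply (hB.inter φ.measurableSet_coe), Set.inter_comm]

theorem pointMeasure_apply_of_isBounded (φ : Config) {B : Set Plane} (hB : MeasurableSet B)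
    (hb : Bornology.IsBounded B) : φ.pointMeasure B = (count B φ : ℝ≥0∞) := by
  rw [pointMeasure_apply φ hB, count, ← (φ.2 B hb).cast_ncard_eq]
  simp

theorem pointMeasure_eq_zero_iff (φ : Config) {B : Set Plane} (hB : MeasurableSet B) :
    φ.pointMeasure B = 0 ↔ ∀ z ∈ φ.1, z ∉ B := by
  rw [pointMeasure_apply φ hB]
  simp [Set.eq_empty_iff_forall_notMem]

/-- The half-open annuli that partition the plane. -/
def annulus (n : ℕ) : Set Plane := {z | ⌊‖z‖⌋₊ = n}

theorem measurableSet_annulus (n : ℕ) : MeasurableSet (annulus n) :=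
  (Nat.measurable_floor.comp measurable_norm) (measurableSet_singleton n)

theorem isBounded_annulus (n : ℕ) : Bornology.IsBounded (annulus n) := by
  refine (Metric.isBounded_ball (x := (0 : Plane)) (r := n + 1)).subset fun z hz => ?_
  rw [mem_ball_zero_iff, ← hz]
  exact Nat.lt_floor_add_one _

theorem measure_eq_tsum_annulus (m : Measure Plane) {B : Set Plane} (hB : MeasurableSet B) :
    m B = ∑' n, m (B ∩ annulus n) := by
  rw [← measure_iUnion]
  · rw [← Set.inter_iUnion]
    congr 1
    ext z
    simp [annulus]
  · intro i i' h
    refine Set.disjoint_left.2 fun z hz hz' => h ?_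
    rw [← hz.2, ← hz'.2]
  · exact fun n => hB.inter (measurableSet_annulus n)

theorem measurable_pointMeasure : Measurable pointMeasure := by
  refine Measure.measurable_of_measurable_coe _ fun B hB => ?_
  simp_rw [fun φ => measure_eq_tsum_annulus (pointMeasure φ) hB]
  refine Measurable.tsum fun n => ?_
  have hb := (isBounded_annulus n).subset (Set.inter_subset_right (s := B))
  have hm := hB.inter (measurableSet_annulus n)
  simp_rw [fun φ => pointMeasure_apply_of_isBounded φ hm hb]
  exact (measurable_of_countable (fun n : ℕ => (n : ℝ≥0∞))).comp (measurable_count hm hb)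

/-- The kernel that maps a configuration to its counting measure. -/
noncomputable def pointKernel : Kernel Config Plane := ⟨pointMeasure, measurable_pointMeasure⟩

@[simp]
theorem pointKernel_apply (φ : Config) : pointKernel φ = φ.pointMeasure := rfl

instance : IsSFiniteKernel pointKernel := by
  classical
  have hs : ∀ n m : ℕ, MeasurableSet {φ | count (annulus n) φ = m} := fun n m =>
    measurable_count (measurableSet_annulus n) (isBounded_annulus n) (measurableSet_singleton m)
  let κ : ℕ × ℕ → Kernel Config Plane := fun a =>
    Kernel.piecewise (hs a.1 a.2) (pointKernel.restrict (measurableSet_annulus a.1)) 0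
  have hfin : ∀ a, IsFiniteKernel (κ a) := by
    intro a
    refine ⟨a.2, ENNReal.natCast_lt_top _, fun φ => ?_⟩
    simp only [κ, Kernel.piecewise_apply, Set.mem_ofPred_eq]
    split_ifs with h
    · rw [Kernel.restrict_apply, Measure.restrict_apply MeasurableSet.univ, Set.univ_inter,
        pointKernel_apply, pointMeasure_apply_of_isBounded _ (measurableSet_annulus _)
        (isBounded_annulus _), h]
    · simp
  have hsum : pointKernel = Kernel.sum κ := by
    ext φ B hB
    rw [Kernel.sum_apply' _ _ hB, ENNReal.tsum_prod', pointKernel_apply,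
      measure_eq_tsum_annulus _ hB]
    congr 1
    ext n
    rw [tsum_eq_single (count (annulus n) φ)]
    · simp [κ, Kernel.piecewise_apply, Kernel.restrict_apply, Measure.restrict_apply hB]
    · intro m hm
      simp [κ, Kernel.piecewise_apply, hm.symm]
  rw [hsum]
  exact Kernel.isSFiniteKernel_sum

/-- The configuration with a point removed. -/
def erase (φ : Config) (p : Plane) : Config :=
  ⟨φ.1 \ {p}, fun B hB => (φ.2 B hB).subset (Set.inter_subset_inter_left _ Set.sdiff_subset)⟩

theorem mem_erase {φ : Config} {p z : Plane} : z ∈ (φ.erase p).1 ↔ z ∈ φ.1 ∧ z ≠ p := Iff.rfl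

theorem measurableSet_mem : MeasurableSet {x : Plane × Config | x.1 ∈ x.2.1} := by
  have h : Measurable fun x : Plane × Config =>
      (Kernel.prodMkLeft Plane pointKernel) x (Prod.mk x ⁻¹' {y | y.2 = y.1.1}) :=
    Kernel.measurable_kernel_prodMk_left
      (measurableSet_eq_fun measurable_snd (measurable_fst.comp measurable_fst))
  convert (measurableSet_singleton (0 : ℝ≥0∞)).compl.preimage h using 1
  ext x
  simp [pointMeasure_eq_zero_iff]

open scoped Classical in
theorem count_erase (φ : Config) (p : Plane) (B : Set Plane) :
    count B (φ.erase p) = count B φ - if p ∈ B ∧ p ∈ φ.1 then 1 else 0 := by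
  unfold count erase
  have h : (φ.1 \ {p}) ∩ B = (φ.1 ∩ B) \ {p} := by
    ext z; simp; tauto
  simp only [h]
  split_ifs with hp
  · have hm : p ∈ φ.1 ∩ B := ⟨hp.2, hp.1⟩
    rw [Set.ncard_sdiff_singleton_of_mem hm]
  · rw [Set.sdiff_singleton_eq_self (fun hm => hp ⟨hm.2, hm.1⟩), Nat.sub_zero]

theorem measurable_of_count {α : Type*} [MeasurableSpace α] {f : α → Config}
    (h : ∀ B, MeasurableSet B → Bornology.IsBounded B → Measurable fun x => count B (f x)) :
    Measurable f := by
  refine Measurable.of_le_map ?_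
  refine iSup_le fun B => iSup_le fun hB => iSup_le fun hb => ?_
  rw [← MeasurableSpace.comap_le_iff_le_map, MeasurableSpace.comap_comp]
  exact (h B hB hb).comap_le

theorem measurable_erase : Measurable fun x : Plane × Config => x.2.erase x.1 := by
  classical
  refine measurable_of_count fun B hB hb => ?_
  simp_rw [count_erase _ _ B]
  refine Measurable.sub ((measurable_count hB hb).comp measurable_snd) ?_
  refine Measurable.ite ?_ measurable_const measurable_const
  exact (measurable_fst hB).inter measurableSet_mem

end Config

theorem lintegral_poissonMeasure (r : ℝ≥0) (f : ℕ → ℝ≥0∞) :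
    ∫⁻ n, f n ∂poissonMeasure r =
      ∑' n, ENNReal.ofReal (Real.exp (-r) * r ^ n / n.factorial) * f n := by
  rw [poissonMeasure, lintegral_sum_measure]
  simp

/-- The size-biased Poisson distribution is the Poisson distribution shifted by one. -/
theorem lintegral_natCast_mul_poissonMeasure (r : ℝ≥0) (g : ℕ → ℝ≥0∞) :
    ∫⁻ n, (n : ℝ≥0∞) * g (n - 1) ∂poissonMeasure r = r * ∫⁻ n, g n ∂poissonMeasure r := by
  rw [lintegral_poissonMeasure, lintegral_poissonMeasure, tsum_eq_zero_add' ENNReal.summable,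
    ← ENNReal.tsum_mul_left]
  simp only [Nat.cast_zero, zero_mul, mul_zero, zero_add, Nat.add_sub_cancel]
  congr 1
  ext n
  rw [← mul_assoc, ← mul_assoc]
  congr 1
  rw [← ENNReal.ofReal_natCast, ← ENNReal.ofReal_mul (by positivity), ← ENNReal.ofReal_coe_nnreal,
    ← ENNReal.ofReal_mul (by positivity)]
  congr 1
  rw [Nat.factorial_succ]
  push_cast
  field_simp
  ring

/-- The Mecke formula for a vector of independent Poisson variables. -/
theorem lintegral_natCast_mul_pi_poissonMeasure {I : Type*} [Fintype I] [DecidableEq I]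
    (r : I → ℝ≥0) (i : I) (g : (I → ℕ) → ℝ≥0∞) :
    ∫⁻ n, (n i : ℝ≥0∞) * g (Function.update n i (n i - 1))
        ∂Measure.pi (fun i => poissonMeasure (r i)) =
      r i * ∫⁻ n, g n ∂Measure.pi (fun i => poissonMeasure (r i)) := by
  rw [← lintegral_const_mul _ (measurable_of_countable _)]
  refine lintegral_eq_of_lmarginal_eq {i} (measurable_of_countable _) (measurable_of_countable _) ?_
  rw [lmarginal_singleton, lmarginal_singleton]
  ext n
  simp only [Function.update_self, Function.update_idem]
  rw [lintegral_const_mul _ (measurable_of_countable _)]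
  exact lintegral_natCast_mul_poissonMeasure (r i) fun m => g (Function.update n i m)

/-- The independence of the counts of a Poisson process in a finite family of disjoint sets. -/
theorem IsPoissonProcess.map_counts {Ω : Type*} [MeasurableSpace Ω] {Φ : Ω → Config} {lam : ℝ}
    {μ : Measure Ω} [IsProbabilityMeasure μ] (h : IsPoissonProcess Φ lam μ) {I : Type*} [Fintype I]
    {C : I → Set Plane} (hC : ∀ i, MeasurableSet (C i)) (hb : ∀ i, Bornology.IsBounded (C i))
    (hd : Pairwise fun i i' => Disjoint (C i) (C i')) :
    μ.map (fun ω i => (Φ ω).count (C i)) =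
      Measure.pi fun i => poissonMeasure (lam * (volume (C i)).toReal).toNNReal := by
  have hm : ∀ i, Measurable fun ω => (Φ ω).count (C i) := fun i =>
    (Config.measurable_count (hC i) (hb i)).comp h.measurable
  have e := Fintype.equivFin I
  have hi : iIndepFun (fun i ω => (Φ ω).count (C i)) μ := by
    have := h.indep _ (fun l => C (e.symm l)) (fun l => hC _) (fun l => hb _)
      (fun l l' hl => hd (e.symm.injective.ne hl))
    simpa using this.precomp e.injective
  rw [(iIndepFun_iff_map_fun_eq_pi_map fun i => (hm i).aemeasurable).1 hi]
  congr 1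
  ext1 i
  exact h.law _ (hC i) (hb i)

/-- A finite family of bounded measurable sets is refined by a finite disjoint one. -/
theorem exists_disjoint_refinement (t : Finset (Set Plane)) (hm : ∀ B ∈ t, MeasurableSet B)
    (hb : ∀ B ∈ t, Bornology.IsBounded B) :
    ∃ (I : Type) (_ : Fintype I) (C : I → Set Plane), (∀ i, MeasurableSet (C i)) ∧
      (∀ i, Bornology.IsBounded (C i)) ∧ (Pairwise fun i i' => Disjoint (C i) (C i')) ∧
      ∀ B ∈ t, ∃ J : Finset I, B = ⋃ i ∈ J, C i := by
  classical
  let C : t.powerset → Set Plane := fun c =>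
    (⋃ B ∈ t, B) ∩ ⋂ B ∈ t, if B ∈ c.1 then B else Bᶜ
  have hmem : ∀ c z, z ∈ C c ↔ (∃ B ∈ t, z ∈ B) ∧ ∀ B ∈ t, (z ∈ B ↔ B ∈ c.1) := by
    intro c z
    simp only [C, Set.mem_inter_iff, Set.mem_iUnion, Set.mem_iInter, exists_prop]
    refine and_congr_right fun _ => forall₂_congr fun B _ => ?_
    split_ifs with h <;> simp [h]
  refine ⟨t.powerset, inferInstance, C, fun c => ?_, fun c => ?_, fun c c' h => ?_, fun B hB => ?_⟩
  · refine (Finset.measurableSet_biUnion t hm).inter (Finset.measurableSet_biInter t fun B hB => ?_)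
    split_ifs
    exacts [hm B hB, (hm B hB).compl]
  · exact ((Bornology.isBounded_biUnion_finset t).2 hb).subset Set.inter_subset_left
  · refine Set.disjoint_left.2 fun z hz hz' => h ?_
    ext B
    have h1 := Finset.mem_powerset.1 c.2
    have h2 := Finset.mem_powerset.1 c'.2
    exact ⟨fun hB => (((hmem _ _).1 hz').2 B (h1 hB)).1 ((((hmem _ _).1 hz).2 B (h1 hB)).2 hB),
      fun hB => (((hmem _ _).1 hz).2 B (h2 hB)).1 ((((hmem _ _).1 hz').2 B (h2 hB)).2 hB)⟩
  · refine ⟨Finset.univ.filter fun c => B ∈ c.1, ?_⟩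
    ext z
    simp only [Finset.mem_filter, Finset.mem_univ, true_and, Set.mem_iUnion, exists_prop]
    constructor
    · intro hz
      refine ⟨⟨t.filter fun B' => z ∈ B', by simp⟩, by simp [hB, hz], ?_⟩
      rw [hmem]
      exact ⟨⟨B, hB, hz⟩, fun B' hB' => by simp [hB']⟩
    · rintro ⟨c, hc, hz⟩
      exact (((hmem _ _).1 hz).2 B hB).2 hc

theorem Config.count_biUnion {I : Type*} (φ : Config) {C : I → Set Plane} (J : Finset I)
    (hb : ∀ i, Bornology.IsBounded (C i)) (hd : Pairwise fun i i' => Disjoint (C i) (C i')) :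
    φ.count (⋃ i ∈ J, C i) = ∑ i ∈ J, φ.count (C i) := by
  classical
  induction J using Finset.induction_on with
  | empty => simp [Config.count]
  | insert a J ha ih =>
    rw [Finset.sum_insert ha, ← ih, Finset.set_biUnion_insert]
    unfold Config.count
    have hd' : Disjoint (φ.1 ∩ C a) (φ.1 ∩ ⋃ i ∈ J, C i) := by
      refine Disjoint.mono Set.inter_subset_right Set.inter_subset_right ?_
      rw [Set.disjoint_iUnion₂_right]
      exact fun i hi => hd (fun h => ha (h ▸ hi))
    rw [Set.inter_union_distrib_left, Set.ncard_union_eq hd' (φ.2 _ (hb a))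
      (φ.2 _ ((Bornology.isBounded_biUnion_finset J).2 fun i _ => hb i))]

/-- The cylinder sets of configurations. -/
def Config.cylinders : Set (Set Config) :=
  piiUnionInter (fun B => {s | MeasurableSet[MeasurableSpace.comap (Config.count B) ⊤] s})
    {B | MeasurableSet B ∧ Bornology.IsBounded B}

theorem Config.isPiSystem_cylinders : IsPiSystem Config.cylinders :=
  isPiSystem_piiUnionInter _ (fun B =>
    @MeasurableSpace.isPiSystem_measurableSet _ (MeasurableSpace.comap (Config.count B) ⊤)) _

theorem Config.generateFrom_cylinders :
    MeasurableSpace.generateFrom Config.cylinders = Config.instMeasurableSpace := by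
  unfold Config.cylinders Config.instMeasurableSpace
  refine (generateFrom_piiUnionInter_measurableSet
    (fun B => MeasurableSpace.comap (Config.count B) ⊤) _).trans ?_
  simp only [Set.mem_ofPred_eq, iSup_and]

theorem Config.exists_of_mem_cylinders {s : Set Config} (hs : s ∈ Config.cylinders) :
    ∃ (t : Finset (Set Plane)) (T : Set Plane → Set ℕ), (∀ B ∈ t, MeasurableSet B) ∧
      (∀ B ∈ t, Bornology.IsBounded B) ∧ s = {φ | ∀ B ∈ t, φ.count B ∈ T B} := by
  obtain ⟨t, ht, f, hf, rfl⟩ := hs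
  choose! T hT using hf
  refine ⟨t, T, fun B hB => (ht hB).1, fun B hB => (ht hB).2, ?_⟩
  ext φ
  simp only [Set.mem_iInter, Set.mem_ofPred_eq]
  refine forall₂_congr fun B hB => ?_
  rw [← (hT B hB).2]
  rfl

/-- The bounded measurable sets. -/
def boundedMeasurable : Set (Set Plane) := {B | MeasurableSet B ∧ Bornology.IsBounded B}

theorem isPiSystem_boundedMeasurable : IsPiSystem boundedMeasurable :=
  fun _ h _ h' _ => ⟨h.1.inter h'.1, h.2.subset Set.inter_subset_left⟩

theorem generateFrom_boundedMeasurable :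
    MeasurableSpace.generateFrom boundedMeasurable = (inferInstance : MeasurableSpace Plane) := by
  refine le_antisymm (MeasurableSpace.generateFrom_le fun B hB => hB.1) fun B hB => ?_
  have : B = ⋃ n : ℕ, B ∩ Metric.ball 0 n := by
    rw [← Set.inter_iUnion, Metric.iUnion_ball_nat, Set.inter_univ]
  rw [this]
  refine MeasurableSet.iUnion fun n => MeasurableSpace.measurableSet_generateFrom
    ⟨MeasurableSet.inter hB measurableSet_ball, Metric.isBounded_ball.subset Set.inter_subset_right⟩

theorem Config.count_erase_eq_update {I : Type*} [DecidableEq I] (φ : Config) {C : I → Set Plane}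
    (hd : Pairwise fun i i' => Disjoint (C i) (C i')) {i : I} {p : Plane} (hp : p ∈ φ.1)
    (hi : p ∈ C i) : (fun l => (φ.erase p).count (C l)) =
      Function.update (fun l => φ.count (C l)) i (φ.count (C i) - 1) := by
  ext l
  rw [Config.count_erase]
  by_cases h : l = i
  · subst h
    simp [hi, hp]
  · have : p ∉ C l := fun hl => Set.disjoint_left.1 (hd h) hl hi
    simp [h, this]

/-- The sum over the points of a process in a cell of a function of the counts of the reduced
configuration. -/
theorem Config.pointMeasure_cell {I : Type*} [DecidableEq I] (φ : Config) {C : I → Set Plane}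
    (hC : ∀ i, MeasurableSet (C i)) (hb : ∀ i, Bornology.IsBounded (C i))
    (hd : Pairwise fun i i' => Disjoint (C i) (C i')) (i : I) (T : Set (I → ℕ))
    {s : Set Config} (hs : s = {φ | (fun l => φ.count (C l)) ∈ T}) (hms : MeasurableSet s) :
    φ.pointMeasure (C i ∩ {p | φ.erase p ∈ s}) = (φ.count (C i) : ℝ≥0∞) * T.indicator 1
      (Function.update (fun l => φ.count (C l)) i (φ.count (C i) - 1)) := by
  have hm : MeasurableSet {p | φ.erase p ∈ s} :=
    (Config.measurable_erase.comp (measurable_id.prodMk measurable_const)) hms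
  have key : ∀ p ∈ φ.1, p ∈ C i → (φ.erase p ∈ s ↔
      Function.update (fun l => φ.count (C l)) i (φ.count (C i) - 1) ∈ T) := by
    intro p hp hi
    rw [← Config.count_erase_eq_update φ hd hp hi, hs]
    rfl
  by_cases h : Function.update (fun l => φ.count (C l)) i (φ.count (C i) - 1) ∈ T
  · rw [Set.indicator_of_mem h, Pi.one_apply, mul_one,
      ← Config.pointMeasure_apply_of_isBounded φ (hC i) (hb i),
      Config.pointMeasure_apply φ ((hC i).inter hm), Config.pointMeasure_apply φ (hC i)]
    congr 2
    ext p
    exact ⟨fun hp => ⟨hp.1, hp.2.1⟩, fun hp => ⟨hp.1, hp.2, (key p hp.1 hp.2).2 h⟩⟩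
  · rw [Set.indicator_of_notMem h, mul_zero, Config.pointMeasure_eq_zero_iff φ ((hC i).inter hm)]
    exact fun p hp hp' => h ((key p hp hp'.1).1 hp'.2)

theorem IsPoissonProcess.lintegral_pointMeasure_cylinder {Ω : Type*} [MeasurableSpace Ω]
    {Φ : Ω → Config} {lam : ℝ} {μ : Measure Ω} [IsProbabilityMeasure μ]
    (h : IsPoissonProcess Φ lam μ) (hlam : 0 ≤ lam) {A : Set Plane} (hA : A ∈ boundedMeasurable)
    {s : Set Config} (hs : s ∈ Config.cylinders) :
    ∫⁻ φ, φ.pointMeasure (A ∩ {p | φ.erase p ∈ s}) ∂(μ.map Φ) =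
      ENNReal.ofReal lam * volume A * μ.map Φ s := by
  classical
  have hms : MeasurableSet s := by
    rw [← Config.generateFrom_cylinders]
    exact MeasurableSpace.measurableSet_generateFrom hs
  obtain ⟨t, T, htm, htb, hst⟩ := Config.exists_of_mem_cylinders hs
  obtain ⟨I, _, C, hC, hb, hd, hJ⟩ := exists_disjoint_refinement (insert A t)
    (by simpa using ⟨hA.1, htm⟩) (by simpa using ⟨hA.2, htb⟩)
  choose! J hJ using hJ
  let T' : Set (I → ℕ) := {n | ∀ B ∈ t, ∑ i ∈ J B, n i ∈ T B}
  have hs' : s = {φ | (fun l => φ.count (C l)) ∈ T'} := by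
    rw [hst]
    ext φ
    refine forall₂_congr fun B hB => ?_
    rw [show φ.count B = ∑ i ∈ J B, φ.count (C i) by
      conv_lhs => rw [hJ B (Finset.mem_insert_of_mem hB), Config.count_biUnion φ _ hb hd]]
  have hcount : Measurable fun (φ : Config) (l : I) => φ.count (C l) :=
    measurable_pi_lambda _ fun l => Config.measurable_count (hC l) (hb l)
  have hlaw := h.map_counts hC hb hd
  rw [show (fun ω i => (Φ ω).count (C i)) = (fun (φ : Config) (l : I) => φ.count (C l)) ∘ Φ from rfl,
    ← Measure.map_map hcount h.measurable] at hlaw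
  have hAJ := hJ A (Finset.mem_insert_self A t)
  have hdis : Set.PairwiseDisjoint (↑(J A)) C := fun i _ i' _ hne => hd hne
  have h1 : ∀ φ : Config, φ.pointMeasure (A ∩ {p | φ.erase p ∈ s}) = ∑ i ∈ J A,
      (φ.count (C i) : ℝ≥0∞) * T'.indicator 1
        (Function.update (fun l => φ.count (C l)) i (φ.count (C i) - 1)) := by
    intro φ
    have hm : MeasurableSet {p | φ.erase p ∈ s} :=
      (Config.measurable_erase.comp (measurable_id.prodMk measurable_const)) hms
    conv_lhs => rw [hAJ, Set.iUnion₂_inter]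
    rw [measure_biUnion_finset (fun i _ i' _ hne => (hd hne).mono Set.inter_subset_left
      Set.inter_subset_left) fun i _ => (hC i).inter hm]
    exact Finset.sum_congr rfl fun i _ => φ.pointMeasure_cell hC hb hd i T' hs' hms
  let G : I → (I → ℕ) → ℝ≥0∞ := fun i n =>
    (n i : ℝ≥0∞) * T'.indicator 1 (Function.update n i (n i - 1))
  have h2 : ∀ i, ∫⁻ φ, G i (fun l => φ.count (C l)) ∂(μ.map Φ) =
      ENNReal.ofReal lam * volume (C i) * μ.map Φ s := by
    intro i
    rw [← lintegral_map (f := G i) (measurable_of_countable _) hcount, hlaw,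
      lintegral_natCast_mul_pi_poissonMeasure, ← hlaw,
      lintegral_map (measurable_of_countable _) hcount]
    congr 1
    · rw [ENNReal.ofNNReal_toNNReal, ENNReal.ofReal_mul hlam,
        ENNReal.ofReal_toReal (hb i).measure_lt_top.ne]
    · rw [← lintegral_indicator_one hms]
      congr 1
      ext φ
      rw [hs']
      rfl
  rw [lintegral_congr h1]
  refine (lintegral_finsetSum _ fun i _ => (measurable_of_countable (G i)).comp hcount).trans ?_
  simp only [Function.comp_apply]
  rw [Finset.sum_congr rfl fun i _ => h2 i, ← Finset.sum_mul, ← Finset.mul_sum]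
  conv_rhs => rw [hAJ, measure_biUnion_finset hdis fun i _ => hC i]

/-- The Mecke formula for a homogeneous Poisson process. -/
theorem IsPoissonProcess.lintegral_mecke {Ω : Type*} [MeasurableSpace Ω]
    {Φ : Ω → Config} {lam : ℝ} {μ : Measure Ω} [IsProbabilityMeasure μ]
    (h : IsPoissonProcess Φ lam μ) (hlam : 0 ≤ lam) {f : Plane × Config → ℝ≥0∞}
    (hf : Measurable f) :
    ∫⁻ φ, ∫⁻ p, f (p, φ.erase p) ∂φ.pointMeasure ∂(μ.map Φ) =
      ENNReal.ofReal lam * ∫⁻ p, ∫⁻ φ, f (p, φ) ∂(μ.map Φ) := by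
  have : IsProbabilityMeasure (μ.map Φ) :=
    Measure.isProbabilityMeasure_map h.measurable.aemeasurable
  have he : Measurable fun x : Config × Plane => (x.2, x.1.erase x.2) :=
    measurable_snd.prodMk (Config.measurable_erase.comp measurable_swap)
  have hprod : (ENNReal.ofReal lam • volume : Measure Plane).prod (μ.map Φ) =
      ((μ.map Φ) ⊗ₘ Config.pointKernel).map fun x => (x.2, x.1.erase x.2) := by
    refine Measure.prod_eq_generateFrom generateFrom_boundedMeasurable
      Config.generateFrom_cylinders isPiSystem_boundedMeasurable Config.isPiSystem_cylinders
      ⟨fun n => Metric.ball 0 n, fun n => ⟨measurableSet_ball, Metric.isBounded_ball⟩, fun n => ?_,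
        Metric.iUnion_ball_nat 0⟩
      ⟨fun n => Set.univ, fun n => ?_, fun n => measure_lt_top _ _,
        Set.iUnion_const _⟩ fun A hA s hs => ?_
    · rw [Measure.smul_apply]
      exact ENNReal.mul_lt_top ENNReal.ofReal_lt_top Metric.isBounded_ball.measure_lt_top
    · exact ⟨∅, by simp, fun _ => Set.univ, fun x hx => absurd hx (Finset.notMem_empty x),
        by simp⟩
    · have hms : MeasurableSet s := by
        rw [← Config.generateFrom_cylinders]
        exact MeasurableSpace.measurableSet_generateFrom hs
      rw [Measure.map_apply he (hA.1.prod hms), Measure.compProd_apply (he (hA.1.prod hms)),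
        Measure.smul_apply, smul_eq_mul, ← h.lintegral_pointMeasure_cylinder hlam hA hs]
      rfl
  refine (Measure.lintegral_compProd (κ := Config.pointKernel)
    (f := fun x => f (x.2, x.1.erase x.2)) (hf.comp he)).symm.trans ?_
  rw [← lintegral_map hf he, ← hprod, lintegral_prod _ hf.aemeasurable,
    lintegral_smul_measure]
  rfl

/-- The configurations of all tiers with a point of tier `k` removed. -/
def eraseTier {ι : Type*} [DecidableEq ι] (k : ι) (p : Plane) (φ : ι → Config) : ι → Config :=
  Function.update φ k ((φ k).erase p)

theorem measurable_eraseTier {ι : Type*} [DecidableEq ι] (k : ι) :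
    Measurable fun x : Plane × (ι → Config) => eraseTier k x.1 x.2 := by
  refine measurable_pi_lambda _ fun i => ?_
  by_cases h : i = k
  · subst h
    simp only [eraseTier, Function.update_self]
    exact Config.measurable_erase.comp
      (measurable_fst.prodMk ((measurable_pi_apply i).comp measurable_snd))
  · simp only [eraseTier, Function.update_of_ne h]
    exact (measurable_pi_apply i).comp measurable_snd

/-- The counting measure of the points of tier `k`. -/
noncomputable def tierKernel {ι : Type*} (k : ι) : Kernel (ι → Config) Plane :=
  Config.pointKernel.comap (fun φ => φ k) (measurable_pi_apply k)

instance {ι : Type*} (k : ι) : IsSFiniteKernel (tierKernel k) :=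
  inferInstanceAs (IsSFiniteKernel (Config.pointKernel.comap _ _))

@[simp]
theorem tierKernel_apply {ι : Type*} (k : ι) (φ : ι → Config) :
    tierKernel k φ = (φ k).pointMeasure := rfl

/-- The Mecke formula for one of several independent Poisson processes. -/
theorem lintegral_mecke_pi {ι : Type*} [Fintype ι] [DecidableEq ι] {Ω : Type*} [MeasurableSpace Ω]
    {Φ : ι → Ω → Config} {lam : ι → ℝ} {μ : Measure Ω} [IsProbabilityMeasure μ]
    (h : ∀ i, IsPoissonProcess (Φ i) (lam i) μ) {k : ι} (hlam : 0 ≤ lam k)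
    {f : Plane × (ι → Config) → ℝ≥0∞} (hf : Measurable f) :
    ∫⁻ φ, ∫⁻ p, f (p, eraseTier k p φ) ∂tierKernel k φ ∂Measure.pi (fun i => μ.map (Φ i)) =
      ENNReal.ofReal (lam k) * ∫⁻ p, ∫⁻ φ, f (p, φ) ∂Measure.pi (fun i => μ.map (Φ i)) := by
  have hP : ∀ i, IsProbabilityMeasure (μ.map (Φ i)) := fun i =>
    Measure.isProbabilityMeasure_map (h i).measurable.aemeasurable
  have hf' : Measurable fun φ : ι → Config => ∫⁻ p, f (p, φ) :=
    Measurable.lintegral_prod_left' hf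
  rw [lintegral_lintegral_swap (f := fun p φ => f (p, φ)) hf.aemeasurable, ← lintegral_const_mul _ hf']
  refine lintegral_eq_of_lmarginal_eq {k} ?_ (hf'.const_mul _) ?_
  · exact Measurable.lintegral_kernel_prod_right'
      (f := fun x : (ι → Config) × Plane => f (x.2, eraseTier k x.2 x.1))
      (hf.comp (measurable_snd.prodMk ((measurable_eraseTier k).comp measurable_swap)))
  · rw [lmarginal_singleton, lmarginal_singleton]
    ext φ
    have hu : Measurable fun x : Plane × Config => (x.1, Function.update φ k x.2) :=
      measurable_fst.prodMk ((measurable_update φ).comp measurable_snd)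
    simp only [eraseTier, tierKernel_apply, Function.update_self, Function.update_idem]
    refine ((h k).lintegral_mecke hlam (hf.comp hu)).trans ?_
    rw [lintegral_const_mul]
    · exact congrArg _ (lintegral_lintegral_swap
        (f := fun p φ' => f (p, Function.update φ k φ')) (hf.comp hu).aemeasurable)
    · exact Measurable.lintegral_prod_left' (hf.comp hu)

namespace Network

variable {ι : Type*} (N : Network ι)

theorem beta_pos (k j : ι) : 0 < N.beta k j := by
  have := N.power_pos k
  have := N.power_pos j
  have := N.bias_pos k
  have := N.bias_pos j
  unfold beta
  positivity

theorem beta_self (k : ι) : N.beta k k = 1 := by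
  have := N.power_pos k
  have := N.bias_pos k
  rw [beta, div_self (by positivity), Real.one_rpow]

theorem beta_swap (k j : ι) : N.beta j k = (N.beta k j)⁻¹ := by
  have := N.power_pos k
  have := N.power_pos j
  have := N.bias_pos k
  have := N.bias_pos j
  rw [beta, beta, ← Real.inv_rpow (by positivity), inv_div]

theorem beta_rpow (k j : ι) :
    N.beta k j ^ (N.η / 2) = (N.bias k * N.power k) / (N.bias j * N.power j) := by
  have := N.power_pos k
  have := N.power_pos j
  have := N.bias_pos k
  have := N.bias_pos j
  have := N.two_lt_η
  rw [beta, ← Real.rpow_mul (by positivity), show 2 / N.η * (N.η / 2) = 1 by field_simp,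
    Real.rpow_one]

/-- The function whose zeros `v` are the points of equal biased received power from the tier `k`
base station at `p` and the tier `j` base station at `z`; it is positive where the former is
stronger. -/
noncomputable def gap (k j : ι) (p z v : Plane) : ℝ :=
  N.beta k j * (‖v - z‖ ^ 2 + N.heightDiff j ^ 2) - (‖v - p‖ ^ 2 + N.heightDiff k ^ 2)

theorem _root_.ENNReal.ofReal_div_lt_ofReal_div_iff {a b x y : ℝ} (ha : 0 < a) (hb : 0 < b)
    (hx : 0 ≤ x) (hy : 0 ≤ y) :
    ENNReal.ofReal a / ENNReal.ofReal x < ENNReal.ofReal b / ENNReal.ofReal y ↔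
      a * y < b * x := by
  rcases hx.eq_or_lt with rfl | hx
  · rw [ENNReal.ofReal_zero, ENNReal.div_zero (by simpa using ha)]
    simpa using mul_nonneg ha.le hy
  rcases hy.eq_or_lt with rfl | hy
  · rw [ENNReal.ofReal_zero, ENNReal.div_zero (by simpa using hb), ← ENNReal.ofReal_div_of_pos hx]
    simpa using mul_pos hb hx
  rw [← ENNReal.ofReal_div_of_pos hx, ← ENNReal.ofReal_div_of_pos hy,
    ENNReal.ofReal_lt_ofReal_iff (by positivity), div_lt_div_iff₀ hx hy]

theorem rss_lt_rss_iff (k j : ι) (p z v : Plane) :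
    N.rss j z v < N.rss k p v ↔ 0 < N.gap k j p z v := by
  have := N.power_pos k
  have := N.power_pos j
  have := N.bias_pos k
  have := N.bias_pos j
  have := N.two_lt_η
  have := N.beta_pos k j
  have hj : 0 < N.bias j * N.power j := by positivity
  rw [rss, rss, ENNReal.ofReal_div_lt_ofReal_div_iff hj (by positivity) (by positivity)
    (by positivity), mul_comm, ← lt_div_iff₀ hj, mul_div_right_comm, ← N.beta_rpow,
    ← Real.mul_rpow (by positivity) (by positivity),
    Real.rpow_lt_rpow_iff (by positivity) (by positivity) (by positivity), gap, sub_pos]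

theorem gap_swap (k j : ι) (p z v : Plane) :
    N.gap j k z p v = -(N.beta k j)⁻¹ * N.gap k j p z v := by
  have := N.beta_pos k j
  rw [gap, gap, N.beta_swap k j]
  field_simp
  ring

theorem rss_le_rss_iff (k j : ι) (p z v : Plane) :
    N.rss j z v ≤ N.rss k p v ↔ 0 ≤ N.gap k j p z v := by
  have := inv_pos.2 (N.beta_pos k j)
  rw [← not_lt, rss_lt_rss_iff, gap_swap, ← not_lt, not_iff_not, neg_mul, neg_pos]
  exact ⟨fun h => by_contra fun h' => absurd h (not_lt.2 (mul_nonneg this.le (not_lt.1 h'))),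
    fun h => mul_neg_of_pos_of_neg this h⟩

theorem rss_eq_rss_iff (k j : ι) (p z v : Plane) :
    N.rss k p v = N.rss j z v ↔ N.gap k j p z v = 0 := by
  have h1 := N.rss_lt_rss_iff k j p z v
  have h2 := N.rss_le_rss_iff k j p z v
  constructor
  · intro h
    exact le_antisymm (not_lt.1 fun h' => absurd h (h1.2 h').ne') (h2.1 h.ge)
  · intro h
    exact le_antisymm (not_lt.1 fun h' => absurd h (h1.1 h').ne') (h2.2 h.ge)

theorem measurable_gap (k j : ι) {α : Type*} [MeasurableSpace α] {f g h : α → Plane}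
    (hf : Measurable f) (hg : Measurable g) (hh : Measurable h) :
    Measurable fun x => N.gap k j (f x) (g x) (h x) := by
  unfold gap
  fun_prop

/-- The location `p` receives a higher biased power from tier `k` than from all stations of `φ`. -/
def IsDominant (k : ι) (p : Plane) (φ : ι → Config) : Prop :=
  ∀ i, ∀ z ∈ (φ i).1, 0 < N.gap k i p z 0

/-- The curve of equal power for `p` and `z` passes at a distance below `d` from the origin. -/
def IsNear (k j : ι) (d : ℝ) (p z : Plane) : Prop := ∃ v, ‖v‖ < d ∧ N.gap k j p z v = 0

/-- The curve of equal power for `p` and a nearest tier `j` station passes at a distance below `d`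
from the origin. -/
def IsNearNearest (k j : ι) (d : ℝ) (p : Plane) (φ : ι → Config) : Prop :=
  ∃ z ∈ (φ j).1, (∀ z' ∈ (φ j).1, ‖z‖ ≤ ‖z'‖) ∧ N.IsNear k j d p z

theorem mem_eraseTier [DecidableEq ι] {k i : ι} {p z : Plane} {φ : ι → Config} :
    z ∈ (eraseTier k p φ i).1 ↔ z ∈ (φ i).1 ∧ ¬ (i = k ∧ z = p) := by
  by_cases h : i = k
  · subst h
    simp [eraseTier, Config.mem_erase]
  · simp [eraseTier, h]

theorem isServing_iff [DecidableEq ι] {φ : ι → Config} {k : ι} {p : Plane} :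
    N.IsServing φ k p ↔ p ∈ (φ k).1 ∧ N.IsDominant k p (eraseTier k p φ) := by
  unfold IsServing IsDominant
  refine and_congr_right fun _ => forall₂_congr fun i z => ?_
  rw [mem_eraseTier, and_imp]
  simp only [rss_lt_rss_iff]

theorem isBestNeighbour_iff [DecidableEq ι] {φ : ι → Config} {k j : ι} {p z : Plane} :
    N.IsBestNeighbour φ k j p z ↔ z ∈ (eraseTier k p φ j).1 ∧
      ∀ z' ∈ (eraseTier k p φ j).1, ‖z‖ ≤ ‖z'‖ := by
  unfold IsBestNeighbour
  rw [mem_eraseTier, and_assoc]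
  refine and_congr_right fun _ => and_congr_right fun _ => forall_congr' fun z' => ?_
  rw [mem_eraseTier, and_imp]
  refine imp_congr_right fun _ => imp_congr_right fun _ => ?_
  rw [rss_le_rss_iff, gap, beta_self]
  simp only [zero_sub, norm_neg, one_mul, add_sub_add_right_eq_sub, sub_nonneg]
  exact sq_le_sq₀ (norm_nonneg _) (norm_nonneg _)

theorem IsServing.unique {φ : ι → Config} {k : ι} {p p' : Plane} (h : N.IsServing φ k p)
    (h' : N.IsServing φ k p') : p = p' := by
  by_contra hne
  exact lt_asymm (h.2 k p' h'.1 fun e => hne e.2.symm) (h'.2 k p h.1 fun e => hne e.2)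

theorem boundaryDist_lt_iff [DecidableEq ι] {φ : ι → Config} {k j : ι} {d : ℝ} :
    N.boundaryDist φ k j < ENNReal.ofReal d ↔
      ∃ p, N.IsServing φ k p ∧ N.IsNearNearest k j d p (eraseTier k p φ) := by
  rw [← zero_mem_extendedBoundary_iff]
  simp only [extendedBoundary, boundary, IsNearNearest, IsNear, Set.mem_ofPred_eq,
    isBestNeighbour_iff, rss_eq_rss_iff, zero_sub, norm_neg]
  constructor
  · rintro ⟨v, ⟨p, z, h1, h2, h3⟩, h4⟩
    exact ⟨p, h1, z, h2.1, h2.2, v, h4, h3⟩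
  · rintro ⟨p, h1, z, h2, h3, v, h4, h5⟩
    exact ⟨v, ⟨p, z, h1, ⟨h2, h3⟩, h5⟩, h4⟩

theorem serviceDist_eq {φ : ι → Config} {k : ι} {p : Plane} (h : N.IsServing φ k p) :
    N.serviceDist φ k = ‖p‖ := by
  have : {p | N.IsServing φ k p} = {p} := by
    ext q
    exact ⟨fun hq => IsServing.unique N hq h, fun hq => hq ▸ h⟩
  rw [serviceDist, this, Metric.infDist_singleton, dist_zero_left]

end Network

section Measurability

variable {α : Type*} [MeasurableSpace α]

theorem measurableSet_exists_mem {g : α → Config} (hg : Measurable g) {S : Set (α × Plane)}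
    (hS : MeasurableSet S) : MeasurableSet {x | ∃ z ∈ (g x).1, (x, z) ∈ S} := by
  have h : Measurable fun x => (Config.pointKernel.comap g hg) x (Prod.mk x ⁻¹' S) :=
    Kernel.measurable_kernel_prodMk_left hS
  convert (measurableSet_singleton (0 : ℝ≥0∞)).compl.preimage h using 1
  ext x
  have hm : MeasurableSet (Prod.mk x ⁻¹' S) := measurable_prodMk_left hS
  simp [Config.pointMeasure_eq_zero_iff _ hm]

theorem measurableSet_forall_mem {g : α → Config} (hg : Measurable g) {S : Set (α × Plane)}
    (hS : MeasurableSet S) : MeasurableSet {x | ∀ z ∈ (g x).1, (x, z) ∈ S} := by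
  convert (measurableSet_exists_mem hg hS.compl).compl using 1
  ext x
  simp

end Measurability

namespace Network

variable {ι : Type*} (N : Network ι)

theorem measurableSet_isDominant [Countable ι] (k : ι) :
    MeasurableSet {x : Plane × (ι → Config) | N.IsDominant k x.1 x.2} := by
  have h : {x : Plane × (ι → Config) | N.IsDominant k x.1 x.2} =
      ⋂ i, {x | ∀ z ∈ (x.2 i).1, 0 < N.gap k i x.1 z 0} := by
    ext x
    simp [IsDominant]
  rw [h]
  refine MeasurableSet.iInter fun i => ?_
  have hS : MeasurableSet {y : (Plane × (ι → Config)) × Plane | 0 < N.gap k i y.1.1 y.2 0} := by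
    exact measurableSet_lt measurable_const (N.measurable_gap k i
      (measurable_fst.comp measurable_fst) measurable_snd measurable_const)
  exact measurableSet_forall_mem ((measurable_pi_apply i).comp measurable_snd) hS

theorem measurableSet_isNear (k j : ι) (d : ℝ) :
    MeasurableSet {x : Plane × Plane | N.IsNear k j d x.1 x.2} := by
  have : {x : Plane × Plane | N.IsNear k j d x.1 x.2} = ⋃ t : {t : ℚ // (t : ℝ) < d},
      {x : Plane × Plane | ∃ v ∈ Metric.closedBall (0 : Plane) t, N.gap k j x.1 x.2 v = 0} := by
    ext x
    simp only [IsNear, Set.mem_ofPred_eq, Set.mem_iUnion, mem_closedBall_zero_iff]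
    constructor
    · rintro ⟨v, hv, h⟩
      obtain ⟨t, h1, h2⟩ := exists_rat_btwn hv
      exact ⟨⟨t, h2⟩, v, h1.le, h⟩
    · rintro ⟨t, v, hv, h⟩
      exact ⟨v, hv.trans_lt t.2, h⟩
  rw [this]
  refine MeasurableSet.iUnion fun t => IsClosed.measurableSet ?_
  have : CompactSpace (Metric.closedBall (0 : Plane) t.1) :=
    isCompact_iff_compactSpace.1 (isCompact_closedBall _ _)
  have hc : Continuous fun y : (Plane × Plane) × Metric.closedBall (0 : Plane) t.1 =>
      N.gap k j y.1.1 y.1.2 y.2 := by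
    unfold gap
    fun_prop
  have hC := isClosed_eq hc (continuous_const (y := (0 : ℝ)))
  convert isClosedMap_fst_of_compactSpace _ hC using 1
  ext x
  simp

theorem measurableSet_isNearNearest (k j : ι) (d : ℝ) :
    MeasurableSet {x : Plane × (ι → Config) | N.IsNearNearest k j d x.1 x.2} := by
  have hS : MeasurableSet {y : (Plane × (ι → Config)) × Plane |
      (∀ z' ∈ (y.1.2 j).1, ‖y.2‖ ≤ ‖z'‖) ∧ N.IsNear k j d y.1.1 y.2} := by
    refine MeasurableSet.inter ?_ ?_
    · have hT : MeasurableSet {w : ((Plane × (ι → Config)) × Plane) × Plane | ‖w.1.2‖ ≤ ‖w.2‖} :=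
        measurableSet_le (measurable_norm.comp (measurable_snd.comp measurable_fst))
          (measurable_norm.comp measurable_snd)
      exact measurableSet_forall_mem
        ((measurable_pi_apply j).comp (measurable_snd.comp measurable_fst)) hT
    · exact ((measurable_fst.comp measurable_fst).prodMk measurable_snd)
        (N.measurableSet_isNear k j d)
  exact measurableSet_exists_mem ((measurable_pi_apply j).comp measurable_snd) hS

theorem measurableSet_exists_isServing [Countable ι] [DecidableEq ι] (k : ι)
    {H : Set (Plane × (ι → Config))} (hH : MeasurableSet H) :
    MeasurableSet {φ : ι → Config | ∃ p, N.IsServing φ k p ∧ (p, eraseTier k p φ) ∈ H} := by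
  have hS : MeasurableSet {y : (ι → Config) × Plane |
      N.IsDominant k y.2 (eraseTier k y.2 y.1) ∧ (y.2, eraseTier k y.2 y.1) ∈ H} :=
    (measurable_snd.prodMk ((measurable_eraseTier k).comp measurable_swap))
      ((N.measurableSet_isDominant k).inter hH)
  convert measurableSet_exists_mem (measurable_pi_apply k) hS using 1
  ext φ
  simp only [isServing_iff, Set.mem_ofPred_eq, and_assoc]

theorem measurableSet_isAssociated [Countable ι] (k : ι) :
    MeasurableSet {φ : ι → Config | N.IsAssociated φ k} := by
  classical
  convert N.measurableSet_exists_isServing k MeasurableSet.univ using 1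
  ext φ
  simp [IsAssociated]

theorem measurable_serviceDist [Countable ι] (k : ι) :
    Measurable fun φ : ι → Config => N.serviceDist φ k := by
  classical
  intro E hE
  have : (fun φ : ι → Config => N.serviceDist φ k) ⁻¹' E =
      {φ | ∃ p, N.IsServing φ k p ∧ (p, eraseTier k p φ) ∈ {x | ‖x.1‖ ∈ E}} ∪
        ({φ | N.IsAssociated φ k}ᶜ ∩ {_φ | (0 : ℝ) ∈ E}) := by
    ext φ
    by_cases h : N.IsAssociated φ k
    · obtain ⟨p, hp⟩ := h
      have ha : N.IsAssociated φ k := ⟨p, hp⟩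
      simp only [Set.mem_preimage, N.serviceDist_eq hp, Set.mem_union, Set.mem_inter_iff,
        Set.mem_compl_iff, Set.mem_ofPred_eq, ha, not_true, false_and, or_false]
      exact ⟨fun hE => ⟨p, hp, hE⟩, fun ⟨q, hq, hE⟩ => IsServing.unique N hq hp ▸ hE⟩
    · have he : {p | N.IsServing φ k p} = ∅ :=
        Set.eq_empty_iff_forall_notMem.2 fun p hp => h ⟨p, hp⟩
      have h0 : N.serviceDist φ k = 0 := by rw [serviceDist, he, Metric.infDist_empty]
      simp only [Set.mem_preimage, h0, Set.mem_union, Set.mem_inter_iff, Set.mem_compl_iff,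
        Set.mem_ofPred_eq, h, not_false_eq_true, true_and]
      exact ⟨Or.inr, fun h' => h'.resolve_left fun ⟨p, hp, _⟩ => h ⟨p, hp⟩⟩
  rw [this]
  refine (N.measurableSet_exists_isServing k ?_).union
    ((N.measurableSet_isAssociated k).compl.inter (MeasurableSet.const _))
  exact (measurable_norm.comp measurable_fst) hE

theorem measurable_boundaryDist [Countable ι] (k j : ι) :
    Measurable fun φ : ι → Config => N.boundaryDist φ k j := by
  classical
  have hreal : ∀ d : ℝ, MeasurableSet {φ : ι → Config | N.boundaryDist φ k j < ENNReal.ofReal d} := by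
    intro d
    simp only [boundaryDist_lt_iff]
    exact N.measurableSet_exists_isServing k (N.measurableSet_isNearNearest k j d)
  refine measurable_of_Iio fun a => ?_
  by_cases ha : a = ∞
  · have : (fun φ : ι → Config => N.boundaryDist φ k j) ⁻¹' Set.Iio a =
        ⋃ n : ℕ, {φ | N.boundaryDist φ k j < ENNReal.ofReal n} := by
      ext φ
      simp only [ha, Set.mem_preimage, Set.mem_Iio, Set.mem_iUnion, Set.mem_ofPred_eq,
        ENNReal.ofReal_natCast]
      exact ⟨fun h => ENNReal.exists_nat_gt h.ne, fun ⟨n, h⟩ => h.trans_le le_top⟩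
    rw [this]
    exact MeasurableSet.iUnion fun n => hreal n
  · rw [← ENNReal.ofReal_toReal ha]
    exact hreal _

end Network

section Poisson

variable {Ω : Type*} [MeasurableSpace Ω] {Φ : Ω → Config} {lam : ℝ} {μ : Measure Ω}
  [IsProbabilityMeasure μ]

theorem IsPoissonProcess.map_forall_count_mem (h : IsPoissonProcess Φ lam μ) {I : Type*}
    [Fintype I] {C : I → Set Plane} (hC : ∀ i, MeasurableSet (C i))
    (hb : ∀ i, Bornology.IsBounded (C i)) (hd : Pairwise fun i i' => Disjoint (C i) (C i'))
    (T : I → Set ℕ) :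
    μ.map Φ {φ | ∀ i, φ.count (C i) ∈ T i} =
      ∏ i, poissonMeasure (lam * (volume (C i)).toReal).toNNReal (T i) := by
  have hcount : Measurable fun (φ : Config) (i : I) => φ.count (C i) :=
    measurable_pi_lambda _ fun l => Config.measurable_count (hC l) (hb l)
  have hT : MeasurableSet (Set.univ.pi T) := MeasurableSet.univ_pi fun i => .of_discrete
  have hlaw := h.map_counts hC hb hd
  rw [show (fun ω i => (Φ ω).count (C i)) = (fun (φ : Config) (i : I) => φ.count (C i)) ∘ Φ from rfl,
    ← Measure.map_map hcount h.measurable] at hlaw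
  rw [← Measure.pi_pi, ← hlaw, Measure.map_apply hcount hT]
  congr 1
  ext φ
  simp

theorem poissonMeasure_zero_singleton (r : ℝ≥0) :
    poissonMeasure r {0} = ENNReal.ofReal (Real.exp (-r)) := by
  simp [poissonMeasure_singleton]

theorem poissonMeasure_one_singleton (r : ℝ≥0) :
    poissonMeasure r {1} = r * ENNReal.ofReal (Real.exp (-r)) := by
  rw [poissonMeasure_singleton, ← ENNReal.ofReal_coe_nnreal, ← ENNReal.ofReal_mul r.coe_nonneg]
  simp [mul_comm]

theorem poissonMeasure_compl_zero_le (r : ℝ≥0) : poissonMeasure r {0}ᶜ ≤ r := by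
  rw [prob_compl_eq_one_sub (measurableSet_singleton 0), poissonMeasure_zero_singleton,
    ← ENNReal.ofReal_one, ← ENNReal.ofReal_sub _ (Real.exp_pos _).le, ← ENNReal.ofReal_coe_nnreal]
  refine ENNReal.ofReal_le_ofReal ?_
  linarith [Real.add_one_le_exp (-(r : ℝ))]

theorem IsPoissonProcess.map_void (h : IsPoissonProcess Φ lam μ) {S : Set Plane}
    (hS : MeasurableSet S) (hSb : Bornology.IsBounded S) :
    μ.map Φ {φ | φ.count S = 0} =
      poissonMeasure (lam * (volume S).toReal).toNNReal {0} := by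
  have := h.map_forall_count_mem (I := Unit) (C := fun _ => S) (fun _ => hS) (fun _ => hSb)
    (fun i i' hne => absurd rfl hne) fun _ => {0}
  simpa using this

theorem coe_rate (hlam : 0 ≤ lam) {A : Set Plane} (hb : Bornology.IsBounded A) :
    ((lam * (volume A).toReal).toNNReal : ℝ≥0∞) = ENNReal.ofReal lam * volume A := by
  rw [ENNReal.ofNNReal_toNNReal, ENNReal.ofReal_mul hlam,
    ENNReal.ofReal_toReal hb.measure_lt_top.ne]

theorem IsPoissonProcess.map_void_inter_ne_zero_le (h : IsPoissonProcess Φ lam μ) (hlam : 0 ≤ lam)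
    {S A : Set Plane} (hS : MeasurableSet S) (hSb : Bornology.IsBounded S) (hA : MeasurableSet A)
    (hAb : Bornology.IsBounded A) (hd : Disjoint S A) :
    μ.map Φ {φ | φ.count S = 0 ∧ φ.count A ≠ 0} ≤
      μ.map Φ {φ | φ.count S = 0} * (ENNReal.ofReal lam * volume A) := by
  have := h.map_forall_count_mem (I := Fin 2) (C := ![S, A])
    (by simp [Fin.forall_fin_two, hS, hA]) (by simp [Fin.forall_fin_two, hSb, hAb])
    (by
      intro i i' hne
      fin_cases i <;> fin_cases i' <;> simp_all [disjoint_comm]) ![{0}, {0}ᶜ]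
  simp only [Fin.forall_fin_two, Fin.prod_univ_two, Matrix.cons_val_zero, Matrix.cons_val_one,
    Set.mem_singleton_iff, Set.mem_compl_iff] at this
  rw [h.map_void hS hSb, this, ← coe_rate hlam hAb]
  gcongr
  exact poissonMeasure_compl_zero_le _

theorem IsPoissonProcess.map_void_inter_eq_one (h : IsPoissonProcess Φ lam μ) (hlam : 0 ≤ lam)
    {S A B : Set Plane} (hS : MeasurableSet S) (hSb : Bornology.IsBounded S) (hA : MeasurableSet A)
    (hAb : Bornology.IsBounded A) (hB : MeasurableSet B) (hBb : Bornology.IsBounded B)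
    (hSA : Disjoint S A) (hSB : Disjoint S B) (hAB : Disjoint A B) :
    μ.map Φ {φ | φ.count S = 0 ∧ φ.count A = 1 ∧ φ.count B = 0} =
      μ.map Φ {φ | φ.count S = 0} * (ENNReal.ofReal lam * volume A *
        ENNReal.ofReal (Real.exp (-(lam * (volume (A ∪ B)).toReal)))) := by
  have := h.map_forall_count_mem (I := Fin 3) (C := ![S, A, B])
    (by simp [Fin.forall_fin_succ, hS, hA, hB]) (by simp [Fin.forall_fin_succ, hSb, hAb, hBb])
    (by
      intro i i' hne
      fin_cases i <;> fin_cases i' <;> simp_all [disjoint_comm]) ![{0}, {1}, {0}]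
  simp only [Fin.forall_fin_succ, Fin.prod_univ_three, Matrix.cons_val_zero, Matrix.cons_val_one,
    Matrix.cons_val_succ, Set.mem_singleton_iff, Matrix.cons_val, IsEmpty.forall_iff, and_true] at this
  rw [h.map_void hS hSb, this, ← coe_rate hlam hAb, mul_assoc, poissonMeasure_one_singleton,
    mul_assoc, poissonMeasure_zero_singleton (lam * (volume B).toReal).toNNReal,
    ← ENNReal.ofReal_mul (Real.exp_pos _).le, ← Real.exp_add, measure_union hAB hB,
    ENNReal.toReal_add hAb.measure_lt_top.ne hBb.measure_lt_top.ne,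
    Real.coe_toNNReal _ (by positivity), Real.coe_toNNReal _ (by positivity)]
  congr 5
  ring

end Poisson

namespace Network

variable {ι : Type*} (N : Network ι)

/-- The region in which a tier `i` station would be preferred to a tier `k` station at `p`. -/
def preferred (k i : ι) (p : Plane) : Set Plane := {z | N.gap k i p z 0 ≤ 0}

theorem measurableSet_preferred (k i : ι) (p : Plane) : MeasurableSet (N.preferred k i p) :=
  measurableSet_le (N.measurable_gap k i measurable_const measurable_id measurable_const)
    measurable_const

theorem isBounded_of_gap_le (k i : ι) (p : Plane) (c d : ℝ) :
    Bornology.IsBounded {z | ∃ v, ‖v‖ ≤ d ∧ N.gap k i p z v ≤ c} := by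
  have hβ := N.beta_pos k i
  refine (Metric.isBounded_closedBall (x := (0 : Plane))
    (r := d + √(((d + ‖p‖) ^ 2 + N.heightDiff k ^ 2 + c) / N.beta k i))).subset ?_
  rintro z ⟨v, hv, h⟩
  rw [mem_closedBall_zero_iff]
  have h1 : ‖z‖ ≤ ‖v‖ + ‖v - z‖ := by
    simpa using norm_sub_le v (v - z)
  refine h1.trans (add_le_add hv (Real.le_sqrt_of_sq_le ?_))
  rw [le_div_iff₀ hβ]
  have h2 : ‖v - p‖ ^ 2 ≤ (d + ‖p‖) ^ 2 := by
    gcongr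
    exact (norm_sub_le _ _).trans (by gcongr)
  unfold gap at h
  nlinarith [mul_nonneg hβ.le (sq_nonneg (N.heightDiff i))]

theorem isBounded_setOf_gap_le (k i : ι) (p : Plane) (c : ℝ) :
    Bornology.IsBounded {z | N.gap k i p z 0 ≤ c} :=
  (N.isBounded_of_gap_le k i p c 0).subset fun z hz => ⟨0, by simp, hz⟩

theorem isBounded_preferred (k i : ι) (p : Plane) : Bornology.IsBounded (N.preferred k i p) :=
  N.isBounded_setOf_gap_le k i p 0

/-- The positions of a less preferred tier `j` station whose curve of equal power is near. -/
def nearRegion (k j : ι) (d : ℝ) (p : Plane) : Set Plane :=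
  {z | 0 < N.gap k j p z 0 ∧ N.IsNear k j d p z}

/-- The positions of a less preferred tier `j` station at which the gap is small. -/
def thinRegion (k j : ι) (c : ℝ) (p : Plane) : Set Plane :=
  {z | 0 < N.gap k j p z 0 ∧ N.gap k j p z 0 < c}

theorem measurableSet_nearRegion (k j : ι) (d : ℝ) :
    MeasurableSet {x : Plane × Plane | x.2 ∈ N.nearRegion k j d x.1} :=
  MeasurableSet.inter (measurableSet_lt measurable_const
    (N.measurable_gap k j measurable_fst measurable_snd measurable_const))
    (N.measurableSet_isNear k j d)

theorem measurableSet_thinRegion (k j : ι) {c : Plane → ℝ} (hc : Measurable c) :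
    MeasurableSet {x : Plane × Plane | x.2 ∈ N.thinRegion k j (c x.1) x.1} :=
  MeasurableSet.inter (measurableSet_lt measurable_const
    (N.measurable_gap k j measurable_fst measurable_snd measurable_const))
    (measurableSet_lt (N.measurable_gap k j measurable_fst measurable_snd measurable_const)
      (hc.comp measurable_fst))

theorem isBounded_nearRegion (k j : ι) (d : ℝ) (p : Plane) :
    Bornology.IsBounded (N.nearRegion k j d p) :=
  (N.isBounded_of_gap_le k j p 0 d).subset fun _ ⟨_, v, hv, h⟩ => ⟨v, hv.le, h.le⟩

theorem isBounded_thinRegion (k j : ι) (c : ℝ) (p : Plane) :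
    Bornology.IsBounded (N.thinRegion k j c p) :=
  (N.isBounded_setOf_gap_le k j p c).subset fun _ h => h.2.le

theorem _root_.Cellular.Config.count_eq_zero_iff (φ : Config) {B : Set Plane}
    (hb : Bornology.IsBounded B) : φ.count B = 0 ↔ ∀ z ∈ φ.1, z ∉ B := by
  rw [Config.count, Set.ncard_eq_zero (φ.2 B hb), Set.eq_empty_iff_forall_notMem]
  simp

theorem isDominant_iff (k : ι) (p : Plane) (φ : ι → Config) :
    N.IsDominant k p φ ↔ ∀ i, (φ i).count (N.preferred k i p) = 0 := by
  refine forall_congr' fun i => ?_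
  rw [Config.count_eq_zero_iff _ (N.isBounded_preferred k i p)]
  simp [preferred]

theorem norm_le_norm_of_gap_le (k j : ι) {p z z' : Plane}
    (h : N.gap k j p z 0 ≤ N.gap k j p z' 0) : ‖z‖ ≤ ‖z'‖ := by
  have hβ := N.beta_pos k j
  simp only [gap, zero_sub, norm_neg, sub_le_sub_iff_right, mul_le_mul_iff_right₀ hβ,
    add_le_add_iff_right] at h
  exact (sq_le_sq₀ (norm_nonneg _) (norm_nonneg _)).1 h

section Law

variable [Fintype ι] {Ω : Type*} [MeasurableSpace Ω] {Φ : ι → Ω → Config} {μ : Measure Ω}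

/-- The joint law of the independent processes of all tiers. -/
noncomputable def law (Φ : ι → Ω → Config) (μ : Measure Ω) : Measure (ι → Config) :=
  Measure.pi fun i => μ.map (Φ i)

theorem isProbabilityMeasure_law [IsProbabilityMeasure μ]
    (hΦ : ∀ i, IsPoissonProcess (Φ i) (N.lam i) μ) : IsProbabilityMeasure (law Φ μ) := by
  have hP : ∀ i, IsProbabilityMeasure (μ.map (Φ i)) := fun i =>
    Measure.isProbabilityMeasure_map (hΦ i).measurable.aemeasurable
  unfold law
  infer_instance

theorem law_pi [IsProbabilityMeasure μ] (hΦ : ∀ i, IsPoissonProcess (Φ i) (N.lam i) μ)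
    (E : ι → Set Config) : law Φ μ (Set.univ.pi E) = ∏ i, μ.map (Φ i) (E i) := by
  have hP : ∀ i, IsProbabilityMeasure (μ.map (Φ i)) := fun i =>
    Measure.isProbabilityMeasure_map (hΦ i).measurable.aemeasurable
  exact Measure.pi_pi _ _

theorem law_isServing [IsProbabilityMeasure μ] [DecidableEq ι]
    (hΦ : ∀ i, IsPoissonProcess (Φ i) (N.lam i) μ)
    (k : ι) {H : Set (Plane × (ι → Config))} (hH : MeasurableSet H) :
    law Φ μ {φ | ∃ p, N.IsServing φ k p ∧ (p, eraseTier k p φ) ∈ H} =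
      ENNReal.ofReal (N.lam k) *
        ∫⁻ p, law Φ μ {φ | N.IsDominant k p φ ∧ (p, φ) ∈ H} := by
  have hS : MeasurableSet {x : Plane × (ι → Config) | N.IsDominant k x.1 x.2 ∧ x ∈ H} :=
    (N.measurableSet_isDominant k).inter hH
  have hf : Measurable
      ({x : Plane × (ι → Config) | N.IsDominant k x.1 x.2 ∧ x ∈ H}.indicator (1 : Plane × (ι → Config) → ℝ≥0∞)) :=
    measurable_one.indicator hS
  have := lintegral_mecke_pi hΦ (k := k) (N.lam_pos k).le hf
  have h1 : ∀ p, ∫⁻ φ, {x : Plane × (ι → Config) | N.IsDominant k x.1 x.2 ∧ x ∈ H}.indicator 1 (p, φ)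
      ∂law Φ μ = law Φ μ {φ | N.IsDominant k p φ ∧ (p, φ) ∈ H} := by
    intro p
    exact lintegral_indicator_one (measurable_prodMk_left (x := p) hS)
  have h2 : ∀ φ, ∫⁻ p, {x : Plane × (ι → Config) | N.IsDominant k x.1 x.2 ∧ x ∈ H}.indicator 1
      (p, eraseTier k p φ) ∂tierKernel k φ =
      {φ | ∃ p, N.IsServing φ k p ∧ (p, eraseTier k p φ) ∈ H}.indicator (1 : (ι → Config) → ℝ≥0∞) φ := by
    intro φ
    have hm : MeasurableSet {p | N.IsDominant k p (eraseTier k p φ) ∧ (p, eraseTier k p φ) ∈ H} :=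
      (measurable_id.prodMk ((measurable_eraseTier k).comp
        (measurable_id.prodMk measurable_const))) hS
    refine (lintegral_indicator_one hm).trans ?_
    rw [tierKernel_apply, Config.pointMeasure_apply _ hm]
    by_cases h : ∃ p, N.IsServing φ k p ∧ (p, eraseTier k p φ) ∈ H
    · obtain ⟨p, hp, hpH⟩ := h
      have hφ : φ ∈ {φ | ∃ p, N.IsServing φ k p ∧ (p, eraseTier k p φ) ∈ H} := ⟨p, hp, hpH⟩
      rw [Set.indicator_of_mem hφ, Pi.one_apply]
      have : (φ k).1 ∩ {p | N.IsDominant k p (eraseTier k p φ) ∧ (p, eraseTier k p φ) ∈ H} = {p} := by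
        ext q
        refine ⟨fun hq => IsServing.unique N ((N.isServing_iff).2 ⟨hq.1, hq.2.1⟩) hp, ?_⟩
        rintro rfl
        exact ⟨hp.1, ((N.isServing_iff).1 hp).2, hpH⟩
      rw [this, Set.encard_singleton]
      simp
    · rw [Set.indicator_of_notMem (show φ ∉ _ from h)]
      have : (φ k).1 ∩ {p | N.IsDominant k p (eraseTier k p φ) ∧ (p, eraseTier k p φ) ∈ H} = ∅ :=
        Set.eq_empty_iff_forall_notMem.2 fun p hp =>
          h ⟨p, (N.isServing_iff).2 ⟨hp.1, hp.2.1⟩, hp.2.2⟩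
      rw [this, Set.encard_empty]
      simp
  rw [← lintegral_indicator_one (N.measurableSet_exists_isServing k hH)]
  refine (lintegral_congr fun φ => (h2 φ).symm).trans (this.trans ?_)
  congr 1
  exact lintegral_congr h1

theorem law_isDominant [IsProbabilityMeasure μ] (hΦ : ∀ i, IsPoissonProcess (Φ i) (N.lam i) μ)
    (k : ι) (p : Plane) : law Φ μ {φ | N.IsDominant k p φ} =
      ∏ i, μ.map (Φ i) {φ | φ.count (N.preferred k i p) = 0} := by
  rw [← N.law_pi hΦ]
  congr 1
  ext φ
  simp [isDominant_iff]

theorem law_isDominant_pos [IsProbabilityMeasure μ]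
    (hΦ : ∀ i, IsPoissonProcess (Φ i) (N.lam i) μ) (k : ι) (p : Plane) :
    0 < law Φ μ {φ | N.IsDominant k p φ} := by
  rw [N.law_isDominant hΦ, pos_iff_ne_zero, Finset.prod_ne_zero_iff]
  intro i _
  rw [(hΦ i).map_void (N.measurableSet_preferred k i p) (N.isBounded_preferred k i p),
    poissonMeasure_zero_singleton]
  exact (ENNReal.ofReal_pos.2 (Real.exp_pos _)).ne'

theorem law_pi_update [IsProbabilityMeasure μ] [DecidableEq ι]
    (hΦ : ∀ i, IsPoissonProcess (Φ i) (N.lam i) μ) (k j : ι) (p : Plane) (F : Set Config) :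
    law Φ μ (Set.univ.pi (Function.update
        (fun i => {φ : Config | φ.count (N.preferred k i p) = 0}) j F)) =
      μ.map (Φ j) F *
        ∏ i ∈ Finset.univ.erase j, μ.map (Φ i) {φ | φ.count (N.preferred k i p) = 0} := by
  rw [N.law_pi hΦ, ← Finset.mul_prod_erase _ _ (Finset.mem_univ j), Function.update_self]
  congr 1
  refine Finset.prod_congr rfl fun i hi => ?_
  rw [Function.update_of_ne (Finset.ne_of_mem_erase hi)]

theorem law_isNearNearest_le [IsProbabilityMeasure μ]
    (hΦ : ∀ i, IsPoissonProcess (Φ i) (N.lam i) μ) (k j : ι) (d : ℝ) (p : Plane) :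
    law Φ μ {φ | N.IsDominant k p φ ∧ N.IsNearNearest k j d p φ} ≤
      law Φ μ {φ | N.IsDominant k p φ} *
        (ENNReal.ofReal (N.lam j) * volume (N.nearRegion k j d p)) := by
  classical
  have hA : MeasurableSet (N.nearRegion k j d p) :=
    measurable_prodMk_left (N.measurableSet_nearRegion k j d)
  have hsub : {φ | N.IsDominant k p φ ∧ N.IsNearNearest k j d p φ} ⊆
      Set.univ.pi (Function.update (fun i => {φ : Config | φ.count (N.preferred k i p) = 0}) j
        {φ | φ.count (N.preferred k j p) = 0 ∧ φ.count (N.nearRegion k j d p) ≠ 0}) := by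
    rintro φ ⟨h1, z, hz, -, hn⟩ i -
    have h1' := (N.isDominant_iff k p φ).1 h1
    by_cases hi : i = j
    · subst hi
      rw [Function.update_self]
      refine ⟨h1' i, fun h0 => ?_⟩
      exact (Config.count_eq_zero_iff _ (N.isBounded_nearRegion k i d p)).1 h0 z hz ⟨h1 i z hz, hn⟩
    · rw [Function.update_of_ne hi]
      exact h1' i
  refine (measure_mono hsub).trans ?_
  rw [N.law_pi_update hΦ, N.law_isDominant hΦ, ← Finset.mul_prod_erase _ _ (Finset.mem_univ j),
    mul_right_comm]
  gcongr
  refine (hΦ j).map_void_inter_ne_zero_le (N.lam_pos j).le (N.measurableSet_preferred k j p)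
    (N.isBounded_preferred k j p) hA (N.isBounded_nearRegion k j d p) ?_
  exact Set.disjoint_left.2 fun z hz hz' => absurd hz'.1 (not_lt.2 hz)

theorem le_law_isNearNearest [IsProbabilityMeasure μ]
    (hΦ : ∀ i, IsPoissonProcess (Φ i) (N.lam i) μ) (k j : ι) (d c : ℝ) (p : Plane) :
    law Φ μ {φ | N.IsDominant k p φ} *
        (ENNReal.ofReal (N.lam j) * volume (N.nearRegion k j d p ∩ N.thinRegion k j c p) *
        ENNReal.ofReal (Real.exp (-(N.lam j * (volume (N.thinRegion k j c p)).toReal)))) ≤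
      law Φ μ {φ | N.IsDominant k p φ ∧ N.IsNearNearest k j d p φ} := by
  classical
  have hA : MeasurableSet (N.nearRegion k j d p) :=
    measurable_prodMk_left (N.measurableSet_nearRegion k j d)
  have hU : MeasurableSet (N.thinRegion k j c p) :=
    measurable_prodMk_left (N.measurableSet_thinRegion k j (c := fun _ => c) measurable_const)
  set A := N.nearRegion k j d p ∩ N.thinRegion k j c p with hAdef
  set B := N.thinRegion k j c p \ N.nearRegion k j d p with hBdef
  have hAb : Bornology.IsBounded A := (N.isBounded_thinRegion k j c p).subset Set.inter_subset_right
  have hBb : Bornology.IsBounded B := (N.isBounded_thinRegion k j c p).subset Set.sdiff_subset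
  have hAB : A ∪ B = N.thinRegion k j c p := by
    ext z; simp only [hAdef, hBdef, Set.mem_union, Set.mem_inter_iff, Set.mem_sdiff]; tauto
  have hsub : Set.univ.pi (Function.update
      (fun i => {φ : Config | φ.count (N.preferred k i p) = 0}) j
        {φ | φ.count (N.preferred k j p) = 0 ∧ φ.count A = 1 ∧ φ.count B = 0}) ⊆
      {φ | N.IsDominant k p φ ∧ N.IsNearNearest k j d p φ} := by
    intro φ hφ
    have hj := hφ j (Set.mem_univ j)
    rw [Function.update_self] at hj
    have hdom : N.IsDominant k p φ := by
      rw [isDominant_iff]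
      intro i
      by_cases hi : i = j
      · exact hi ▸ hj.1
      · have := hφ i (Set.mem_univ i)
        rwa [Function.update_of_ne hi] at this
    refine ⟨hdom, ?_⟩
    obtain ⟨z, hz⟩ := Set.ncard_eq_one.1 hj.2.1
    have hzm : z ∈ (φ j).1 ∩ A := hz ▸ rfl
    refine ⟨z, hzm.1, fun z' hz' => ?_, hzm.2.1.2⟩
    by_cases hzA : z' ∈ A
    · have : z' ∈ (φ j).1 ∩ A := ⟨hz', hzA⟩
      rw [hz] at this
      exact (congrArg norm (Set.mem_singleton_iff.1 this)).ge
    · have hzB := (Config.count_eq_zero_iff _ hBb).1 hj.2.2 z' hz'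
      refine N.norm_le_norm_of_gap_le k j (p := p) (hzm.2.2.2.le.trans (not_lt.1 fun hlt => ?_))
      have hzU : z' ∈ A ∪ B := by
        rw [hAB]
        exact ⟨hdom j z' hz', hlt⟩
      exact hzU.elim hzA hzB
  refine le_trans (le_of_eq ?_) (measure_mono hsub)
  rw [N.law_pi_update hΦ, N.law_isDominant hΦ, ← Finset.mul_prod_erase _ _ (Finset.mem_univ j),
    (hΦ j).map_void_inter_eq_one (N.lam_pos j).le (N.measurableSet_preferred k j p)
    (N.isBounded_preferred k j p) (hA.inter hU) hAb (hU.diff hA) hBb, hAB, mul_right_comm]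
  · exact Set.disjoint_left.2 fun z hz hz' => absurd hz'.1.1 (not_lt.2 hz)
  · exact Set.disjoint_left.2 fun z hz hz' => absurd hz'.1.1 (not_lt.2 hz)
  · exact Set.disjoint_left.2 fun z hz hz' => hz'.2 hz.1

end Law

theorem gap_linearIsometryEquiv (k j : ι) (ρ : Plane ≃ₗᵢ[ℝ] Plane) (p z v : Plane) :
    N.gap k j (ρ p) (ρ z) (ρ v) = N.gap k j p z v := by
  simp only [gap, ← map_sub, LinearIsometryEquiv.norm_map]

theorem preimage_nearRegion (k j : ι) (d : ℝ) (ρ : Plane ≃ₗᵢ[ℝ] Plane) (p : Plane) :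
    ρ ⁻¹' N.nearRegion k j d (ρ p) = N.nearRegion k j d p := by
  ext z
  have h0 : N.gap k j (ρ p) (ρ z) 0 = N.gap k j p z 0 := by
    rw [← N.gap_linearIsometryEquiv k j ρ p z 0, map_zero]
  simp only [nearRegion, IsNear, Set.mem_preimage, Set.mem_ofPred_eq, h0]
  refine and_congr_right fun _ => ⟨?_, ?_⟩
  · rintro ⟨v, hv, h⟩
    refine ⟨ρ.symm v, by simpa using hv, ?_⟩
    rwa [← N.gap_linearIsometryEquiv k j ρ, ρ.apply_symm_apply]
  · rintro ⟨v, hv, h⟩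
    exact ⟨ρ v, by simpa using hv, by rwa [N.gap_linearIsometryEquiv]⟩

theorem preimage_thinRegion (k j : ι) (c : ℝ) (ρ : Plane ≃ₗᵢ[ℝ] Plane) (p : Plane) :
    ρ ⁻¹' N.thinRegion k j c (ρ p) = N.thinRegion k j c p := by
  ext z
  have h0 : N.gap k j (ρ p) (ρ z) 0 = N.gap k j p z 0 := by
    rw [← N.gap_linearIsometryEquiv k j ρ p z 0, map_zero]
  simp only [thinRegion, Set.mem_preimage, Set.mem_ofPred_eq, h0]

theorem _root_.Cellular.volume_preimage_linearIsometryEquiv (ρ : Plane ≃ₗᵢ[ℝ] Plane)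
    (s : Set Plane) : volume (ρ ⁻¹' s) = volume s :=
  ρ.measurePreserving.measure_preimage_emb ρ.toHomeomorph.measurableEmbedding s

/-- The point at distance `r` from the origin on the first coordinate axis. -/
noncomputable def _root_.Cellular.axisPoint (r : ℝ) : Plane := EuclideanSpace.single 0 r

theorem _root_.Cellular.norm_axisPoint (r : ℝ) : ‖axisPoint r‖ = |r| := by
  simp [axisPoint]

theorem _root_.Cellular.measurable_axisPoint : Measurable axisPoint := by
  unfold axisPoint
  have : Continuous fun r : ℝ => (EuclideanSpace.single 0 r : Plane) :=
    (isometry_iff_dist_eq.2 fun x y => by simp).continuous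
  exact this.measurable

theorem _root_.Cellular.exists_map_eq_axisPoint (p : Plane) :
    ∃ ρ : Plane ≃ₗᵢ[ℝ] Plane, ρ p = axisPoint ‖p‖ :=
  ⟨_, Submodule.reflection_sub (by simp [norm_axisPoint])⟩

theorem volume_nearRegion_eq (k j : ι) (d : ℝ) (p : Plane) :
    volume (N.nearRegion k j d p) = volume (N.nearRegion k j d (axisPoint ‖p‖)) := by
  obtain ⟨ρ, hρ⟩ := exists_map_eq_axisPoint p
  rw [← hρ, ← volume_preimage_linearIsometryEquiv ρ (N.nearRegion _ _ _ (ρ p)), preimage_nearRegion]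

theorem volume_thinRegion_eq (k j : ι) (c : ℝ) (p : Plane) :
    volume (N.thinRegion k j c p) = volume (N.thinRegion k j c (axisPoint ‖p‖)) := by
  obtain ⟨ρ, hρ⟩ := exists_map_eq_axisPoint p
  rw [← hρ, ← volume_preimage_linearIsometryEquiv ρ (N.thinRegion _ _ _ (ρ p)), preimage_thinRegion]

theorem volume_nearRegion_inter_thinRegion_eq (k j : ι) (d c : ℝ) (p : Plane) :
    volume (N.nearRegion k j d p ∩ N.thinRegion k j c p) =
      volume (N.nearRegion k j d (axisPoint ‖p‖) ∩ N.thinRegion k j c (axisPoint ‖p‖)) := by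
  obtain ⟨ρ, hρ⟩ := exists_map_eq_axisPoint p
  rw [← hρ, ← volume_preimage_linearIsometryEquiv ρ (N.nearRegion _ _ _ (ρ p) ∩ _),
    Set.preimage_inter, preimage_nearRegion,
    preimage_thinRegion]

/-- The upper bound for the conditional probability at service distance `r`. -/
noncomputable def upperBound (k j : ι) (d r : ℝ) : ℝ≥0∞ :=
  ENNReal.ofReal (N.lam j) * volume (N.nearRegion k j d (axisPoint r))

/-- The lower bound for the conditional probability at service distance `r`, from the stations in
the thin region where the gap is below `c r`. -/
noncomputable def lowerBound (k j : ι) (c : ℝ → ℝ) (d r : ℝ) : ℝ≥0∞ :=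
  ENNReal.ofReal (N.lam j) *
    volume (N.nearRegion k j d (axisPoint r) ∩ N.thinRegion k j (c r) (axisPoint r)) *
    ENNReal.ofReal (Real.exp (-(N.lam j * (volume (N.thinRegion k j (c r) (axisPoint r))).toReal)))

theorem measurable_upperBound (k j : ι) (d : ℝ) : Measurable (N.upperBound k j d) :=
  ((measurable_measure_prodMk_left (N.measurableSet_nearRegion k j d)).comp
    measurable_axisPoint).const_mul _

theorem measurable_lowerBound (k j : ι) {c : ℝ → ℝ} (hc : Measurable c) (d : ℝ) :
    Measurable (N.lowerBound k j c d) := by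
  have hg : Measurable fun x : ℝ × Plane => N.gap k j (axisPoint x.1) x.2 0 :=
    N.measurable_gap k j (measurable_axisPoint.comp measurable_fst) measurable_snd measurable_const
  have h1 : MeasurableSet {x : ℝ × Plane | x.2 ∈ N.nearRegion k j d (axisPoint x.1)} :=
    ((measurable_axisPoint.comp measurable_fst).prodMk measurable_snd)
      (N.measurableSet_nearRegion k j d)
  have h2 : MeasurableSet {x : ℝ × Plane | x.2 ∈ N.thinRegion k j (c x.1) (axisPoint x.1)} :=
    (measurableSet_lt measurable_const hg).inter (measurableSet_lt hg (hc.comp measurable_fst))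
  have m1 : Measurable fun r => volume
      (N.nearRegion k j d (axisPoint r) ∩ N.thinRegion k j (c r) (axisPoint r)) :=
    measurable_measure_prodMk_left (h1.inter h2)
  have m2 : Measurable fun r => volume (N.thinRegion k j (c r) (axisPoint r)) :=
    measurable_measure_prodMk_left h2
  exact (m1.const_mul _).mul (ENNReal.measurable_ofReal.comp
    (Real.measurable_exp.comp (m2.ennreal_toReal.const_mul _).neg))

theorem measurable_configs {Ω : Type*} [MeasurableSpace Ω] {Φ : ι → Ω → Config} {μ : Measure Ω}
    (hΦ : ∀ i, IsPoissonProcess (Φ i) (N.lam i) μ) : Measurable fun ω i => Φ i ω :=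
  measurable_pi_lambda _ fun i => (hΦ i).measurable

section Measurability

variable [Fintype ι] {Ω : Type*} [MeasurableSpace Ω] {Φ : ι → Ω → Config} {μ : Measure Ω}

theorem measurableSet_isAssociated_configs (hΦ : ∀ i, IsPoissonProcess (Φ i) (N.lam i) μ) (k : ι) :
    MeasurableSet {ω | N.IsAssociated (fun i => Φ i ω) k} :=
  (N.measurable_configs hΦ) (N.measurableSet_isAssociated k)

theorem measurable_serviceDist_configs (hΦ : ∀ i, IsPoissonProcess (Φ i) (N.lam i) μ) (k : ι) :
    Measurable fun ω => N.serviceDist (fun i => Φ i ω) k :=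
  (N.measurable_serviceDist k).comp (N.measurable_configs hΦ)

theorem measurable_boundaryDist_configs (hΦ : ∀ i, IsPoissonProcess (Φ i) (N.lam i) μ)
    (k j : ι) : Measurable fun ω => N.boundaryDist (fun i => Φ i ω) k j :=
  (N.measurable_boundaryDist k j).comp (N.measurable_configs hΦ)

end Measurability

section Law

variable [Fintype ι] {Ω : Type*} [MeasurableSpace Ω] {Φ : ι → Ω → Config} {μ : Measure Ω}
  [IsProbabilityMeasure μ]

theorem map_eq_law (hΦ : ∀ i, IsPoissonProcess (Φ i) (N.lam i) μ) (hindep : iIndepFun Φ μ) :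
    μ.map (fun ω i => Φ i ω) = law Φ μ :=
  (iIndepFun_iff_map_fun_eq_pi_map fun i => (hΦ i).measurable.aemeasurable).1 hindep

/-- The probability that a station of tier `k` at `p` would be the serving one. -/
noncomputable def domProb (Φ : ι → Ω → Config) (μ : Measure Ω) (k : ι) (p : Plane) : ℝ≥0∞ :=
  law Φ μ {φ | N.IsDominant k p φ}

theorem measurable_domProb (hΦ : ∀ i, IsPoissonProcess (Φ i) (N.lam i) μ) (k : ι) :
    Measurable (N.domProb Φ μ k) := by
  have := N.isProbabilityMeasure_law hΦ
  exact measurable_measure_prodMk_left (N.measurableSet_isDominant k)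

theorem measure_isServing [DecidableEq ι] (hΦ : ∀ i, IsPoissonProcess (Φ i) (N.lam i) μ)
    (hindep : iIndepFun Φ μ) (k : ι) {H : Set (Plane × (ι → Config))} (hH : MeasurableSet H) :
    μ {ω | ∃ p, N.IsServing (fun i => Φ i ω) k p ∧ (p, eraseTier k p fun i => Φ i ω) ∈ H} =
      ENNReal.ofReal (N.lam k) * ∫⁻ p, law Φ μ {φ | N.IsDominant k p φ ∧ (p, φ) ∈ H} := by
  rw [← N.law_isServing hΦ k hH, ← N.map_eq_law hΦ hindep,
    Measure.map_apply (N.measurable_configs hΦ) (N.measurableSet_exists_isServing k hH)]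
  rfl

theorem measure_isServing_norm_mem [DecidableEq ι]
    (hΦ : ∀ i, IsPoissonProcess (Φ i) (N.lam i) μ) (hindep : iIndepFun Φ μ) (k : ι)
    {H : Set (Plane × (ι → Config))} (hH : MeasurableSet H) {E : Set ℝ} (hE : MeasurableSet E) :
    μ {ω | ∃ p, N.IsServing (fun i => Φ i ω) k p ∧ ‖p‖ ∈ E ∧
        (p, eraseTier k p fun i => Φ i ω) ∈ H} =
      ENNReal.ofReal (N.lam k) *
        ∫⁻ p in norm ⁻¹' E, law Φ μ {φ | N.IsDominant k p φ ∧ (p, φ) ∈ H} := by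
  have hE' : MeasurableSet {x : Plane × (ι → Config) | ‖x.1‖ ∈ E} :=
    (measurable_norm.comp measurable_fst) hE
  refine (N.measure_isServing hΦ hindep k (hE'.inter hH)).trans ?_
  rw [← lintegral_indicator (measurable_norm hE)]
  congr 2
  ext p
  by_cases hp : ‖p‖ ∈ E
  · rw [Set.indicator_of_mem (show p ∈ norm ⁻¹' E from hp)]
    simp [hp]
  · rw [Set.indicator_of_notMem (show p ∉ norm ⁻¹' E from hp)]
    simp [hp]

theorem measure_isAssociated_pos (hΦ : ∀ i, IsPoissonProcess (Φ i) (N.lam i) μ)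
    (hindep : iIndepFun Φ μ) (k : ι) : 0 < μ {ω | N.IsAssociated (fun i => Φ i ω) k} := by
  classical
  have h := N.measure_isServing hΦ hindep k MeasurableSet.univ
  simp only [Set.mem_univ, and_true] at h
  change 0 < μ {ω | ∃ p, N.IsServing (fun i => Φ i ω) k p}
  rw [h]
  refine ENNReal.mul_pos (ENNReal.ofReal_pos.2 (N.lam_pos k)).ne' ?_
  refine (lt_of_le_of_ne zero_le fun h0 => ?_).ne'
  have h1 := (lintegral_eq_zero_iff (N.measurable_domProb hΦ k)).1 h0.symm
  have h2 : ∀ᵐ p : Plane, False := by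
    filter_upwards [h1] with p hp
    exact (N.law_isDominant_pos hΦ k p).ne' hp
  rw [ae_iff] at h2
  simp at h2

/-- The law of the service distance given the tier. -/
noncomputable def distLaw (Φ : ι → Ω → Config) (μ : Measure Ω) (k : ι) : Measure ℝ :=
  (N.assocMeasure Φ μ k).map fun ω => N.serviceDist (fun i => Φ i ω) k

instance (k : ι) : IsFiniteMeasure (N.distLaw Φ μ k) := by
  unfold distLaw
  infer_instance

theorem assocMeasure_serviceDist_mem_inter [DecidableEq ι]
    (hΦ : ∀ i, IsPoissonProcess (Φ i) (N.lam i) μ) (hindep : iIndepFun Φ μ) (k : ι)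
    {H : Set (Plane × (ι → Config))} (hH : MeasurableSet H) {E : Set ℝ} (hE : MeasurableSet E) :
    N.assocMeasure Φ μ k ((fun ω => N.serviceDist (fun i => Φ i ω) k) ⁻¹' E ∩
        {ω | ∃ p, N.IsServing (fun i => Φ i ω) k p ∧ (p, eraseTier k p fun i => Φ i ω) ∈ H}) =
      (μ {ω | N.IsAssociated (fun i => Φ i ω) k})⁻¹ * (ENNReal.ofReal (N.lam k) *
        ∫⁻ p in norm ⁻¹' E, law Φ μ {φ | N.IsDominant k p φ ∧ (p, φ) ∈ H}) := by
  rw [assocMeasure, cond_apply (N.measurableSet_isAssociated_configs hΦ k),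
    ← N.measure_isServing_norm_mem hΦ hindep k hH hE]
  congr 2
  ext ω
  simp only [Set.mem_inter_iff, Set.mem_preimage, Set.mem_ofPred_eq]
  constructor
  · rintro ⟨-, hX, p, hp, h⟩
    exact ⟨p, hp, N.serviceDist_eq hp ▸ hX, h⟩
  · rintro ⟨p, hp, hX, h⟩
    exact ⟨⟨p, hp⟩, (N.serviceDist_eq hp).symm ▸ hX, p, hp, h⟩

theorem distLaw_eq (hΦ : ∀ i, IsPoissonProcess (Φ i) (N.lam i) μ) (hindep : iIndepFun Φ μ)
    (k : ι) : N.distLaw Φ μ k =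
      ((μ {ω | N.IsAssociated (fun i => Φ i ω) k})⁻¹ * ENNReal.ofReal (N.lam k)) •
        ((volume.withDensity (N.domProb Φ μ k)).map norm) := by
  classical
  ext E hE
  rw [distLaw, Measure.map_apply (N.measurable_serviceDist_configs hΦ k) hE, Measure.smul_apply,
    Measure.map_apply measurable_norm hE, withDensity_apply _ (measurable_norm hE), smul_eq_mul,
    mul_assoc]
  have h := N.assocMeasure_serviceDist_mem_inter hΦ hindep k MeasurableSet.univ hE
  simp only [Set.mem_univ, and_true] at h
  refine Eq.trans ?_ h
  rw [assocMeasure, cond_apply (N.measurableSet_isAssociated_configs hΦ k),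
    cond_apply (N.measurableSet_isAssociated_configs hΦ k)]
  congr 2
  ext ω
  exact ⟨fun h => ⟨h.1, h.2, h.1⟩, fun h => ⟨h.1, h.2.1⟩⟩

theorem setLIntegral_distLaw (hΦ : ∀ i, IsPoissonProcess (Φ i) (N.lam i) μ)
    (hindep : iIndepFun Φ μ) (k : ι) {u : ℝ → ℝ≥0∞} (hu : Measurable u) {E : Set ℝ}
    (hE : MeasurableSet E) : ∫⁻ r in E, u r ∂N.distLaw Φ μ k =
      (μ {ω | N.IsAssociated (fun i => Φ i ω) k})⁻¹ * (ENNReal.ofReal (N.lam k) *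
        ∫⁻ p in norm ⁻¹' E, N.domProb Φ μ k p * u ‖p‖) := by
  rw [N.distLaw_eq hΦ hindep, Measure.restrict_smul, lintegral_smul_measure, smul_eq_mul,
    setLIntegral_map hE hu measurable_norm, mul_assoc]
  congr 2
  exact setLIntegral_withDensity_eq_setLIntegral_mul _ (N.measurable_domProb hΦ k)
    (hu.comp measurable_norm) (measurable_norm hE)

theorem setLIntegral_condDistrib_distLaw (hΦ : ∀ i, IsPoissonProcess (Φ i) (N.lam i) μ)
    (hindep : iIndepFun Φ μ) (k j : ι) (d : ℝ) {E : Set ℝ} (hE : MeasurableSet E) :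
    ∫⁻ r in E, condDistrib (fun ω => N.boundaryDist (fun i => Φ i ω) k j)
        (fun ω => N.serviceDist (fun i => Φ i ω) k) (N.assocMeasure Φ μ k) r
        (Set.Iio (ENNReal.ofReal d)) ∂N.distLaw Φ μ k =
      (μ {ω | N.IsAssociated (fun i => Φ i ω) k})⁻¹ * (ENNReal.ofReal (N.lam k) *
        ∫⁻ p in norm ⁻¹' E, law Φ μ {φ | N.IsDominant k p φ ∧ N.IsNearNearest k j d p φ}) := by
  classical
  rw [distLaw, setLIntegral_map hE (Kernel.measurable_coe _ measurableSet_Iio)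
    (N.measurable_serviceDist_configs hΦ k),
    setLIntegral_preimage_condDistrib (N.measurable_serviceDist_configs hΦ k)
    (N.measurable_boundaryDist_configs hΦ k j).aemeasurable measurableSet_Iio hE]
  refine Eq.trans ?_
    (N.assocMeasure_serviceDist_mem_inter hΦ hindep k (N.measurableSet_isNearNearest k j d) hE)
  congr 2
  ext ω
  exact N.boundaryDist_lt_iff

theorem condDistrib_le_upperBound (hΦ : ∀ i, IsPoissonProcess (Φ i) (N.lam i) μ)
    (hindep : iIndepFun Φ μ) (k j : ι) (d : ℝ) : ∀ᵐ r ∂N.distLaw Φ μ k,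
      condDistrib (fun ω => N.boundaryDist (fun i => Φ i ω) k j)
        (fun ω => N.serviceDist (fun i => Φ i ω) k) (N.assocMeasure Φ μ k) r
        (Set.Iio (ENNReal.ofReal d)) ≤ N.upperBound k j d r := by
  refine ae_le_of_forall_setLIntegral_le_of_sigmaFinite
    (Kernel.measurable_coe _ measurableSet_Iio) fun E hE _ => ?_
  rw [N.setLIntegral_condDistrib_distLaw hΦ hindep k j d hE,
    N.setLIntegral_distLaw hΦ hindep k (N.measurable_upperBound k j d) hE]
  gcongr with p
  rw [upperBound, ← volume_nearRegion_eq]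
  exact N.law_isNearNearest_le hΦ k j d p

theorem lowerBound_le_condDistrib (hΦ : ∀ i, IsPoissonProcess (Φ i) (N.lam i) μ)
    (hindep : iIndepFun Φ μ) (k j : ι) {c : ℝ → ℝ} (hc : Measurable c) (d : ℝ) :
    ∀ᵐ r ∂N.distLaw Φ μ k, N.lowerBound k j c d r ≤
      condDistrib (fun ω => N.boundaryDist (fun i => Φ i ω) k j)
        (fun ω => N.serviceDist (fun i => Φ i ω) k) (N.assocMeasure Φ μ k) r
        (Set.Iio (ENNReal.ofReal d)) := by
  refine ae_le_of_forall_setLIntegral_le_of_sigmaFinite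
    (N.measurable_lowerBound k j hc d) fun E hE _ => ?_
  rw [N.setLIntegral_condDistrib_distLaw hΦ hindep k j d hE,
    N.setLIntegral_distLaw hΦ hindep k (N.measurable_lowerBound k j hc d) hE]
  gcongr with p
  rw [lowerBound, ← volume_thinRegion_eq, ← volume_nearRegion_inter_thinRegion_eq]
  exact N.le_law_isNearNearest hΦ k j d (c ‖p‖) p

theorem ae_distLaw_of_ae_volume (hΦ : ∀ i, IsPoissonProcess (Φ i) (N.lam i) μ)
    (hindep : iIndepFun Φ μ) (k : ι) {q : ℝ → Prop} (hq : MeasurableSet {r | q r})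
    (h : ∀ᵐ p : Plane, q ‖p‖) : ∀ᵐ r ∂N.distLaw Φ μ k, q r := by
  rw [N.distLaw_eq hΦ hindep]
  refine Measure.ae_smul_measure ?_ _
  rw [ae_map_iff measurable_norm.aemeasurable hq]
  exact (withDensity_absolutelyContinuous _ _).ae_le h

theorem ae_nonneg_distLaw (hΦ : ∀ i, IsPoissonProcess (Φ i) (N.lam i) μ)
    (hindep : iIndepFun Φ μ) (k : ι) : ∀ᵐ r ∂N.distLaw Φ μ k, 0 ≤ r :=
  N.ae_distLaw_of_ae_volume hΦ hindep k measurableSet_Ici (.of_forall fun _ => norm_nonneg _)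

theorem ae_ne_zero_distLaw (hΦ : ∀ i, IsPoissonProcess (Φ i) (N.lam i) μ)
    (hindep : iIndepFun Φ μ) (k j : ι) : ∀ᵐ r ∂N.distLaw Φ μ k,
      (r ^ 2 + N.heightDiff k ^ 2) / N.beta k j - N.heightDiff j ^ 2 ≠ 0 := by
  refine N.ae_distLaw_of_ae_volume hΦ hindep k (MeasurableSet.compl
    (measurableSet_eq_fun (by fun_prop) measurable_const)) ?_
  have hβ := N.beta_pos k j
  simp only [ae_iff, not_not]
  refine measure_mono_null (t := Metric.sphere 0
    (√(N.heightDiff j ^ 2 * N.beta k j - N.heightDiff k ^ 2))) ?_ (Measure.addHaar_sphere _ _ _)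
  intro p hp
  have hp' : (‖p‖ ^ 2 + N.heightDiff k ^ 2) / N.beta k j - N.heightDiff j ^ 2 = 0 := hp
  have h2 : N.heightDiff j ^ 2 * N.beta k j - N.heightDiff k ^ 2 = ‖p‖ ^ 2 := by
    field_simp at hp'
    linarith
  rw [mem_sphere_zero_iff_norm, h2, Real.sqrt_sq (norm_nonneg p)]

end Law

end Network

section Polar

theorem lintegral_ofReal_Ioo {a b : ℝ} (hab : a ≤ b) (ha : 0 ≤ a) :
    ∫⁻ x in Set.Ioo a b, ENNReal.ofReal x = ENNReal.ofReal ((b ^ 2 - a ^ 2) / 2) := by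
  rw [← ofReal_integral_eq_lintegral_ofReal, ← integral_Ioc_eq_integral_Ioo,
    ← intervalIntegral.integral_of_le hab, integral_id]
  · exact (continuous_id.integrableOn_Icc (a := a) (b := b)).mono_set Set.Ioo_subset_Icc_self
  · exact (ae_restrict_iff' measurableSet_Ioo).2 (.of_forall fun x hx => ha.trans hx.1.le)

/-- The points outside of the disc of radius `R` whose squared distance to the origin exceeds `R²`
by less than `ψ`, a function of the cosine of the polar angle. -/
def polarRegion (R : ℝ) (ψ : ℝ → ℝ) : Set Plane :=
  {z | R ^ 2 < ‖z‖ ^ 2 ∧ ‖z‖ ^ 2 < R ^ 2 + ψ (z 0 / ‖z‖)}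

theorem lintegral_plane_eq_polar {f : ℝ × ℝ → ℝ≥0∞} (hf : Measurable f) :
    ∫⁻ z : Plane, f (z 0, z 1) = ∫⁻ θ in Set.Ioo (-Real.pi) Real.pi, ∫⁻ ρ in Set.Ioi (0 : ℝ),
      ENNReal.ofReal ρ * f (ρ * Real.cos θ, ρ * Real.sin θ) := by
  have hm : MeasurePreserving (fun z : Plane => (z 0, z 1)) :=
    (volume_preserving_finTwoArrow ℝ).comp
      (EuclideanSpace.volume_preserving_symm_measurableEquiv_toLp (Fin 2))
  rw [hm.lintegral_comp hf, ← lintegral_comp_polarCoord_symm]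
  simp only [polarCoord_target, polarCoord_symm_apply, smul_eq_mul]
  rw [Measure.volume_eq_prod, ← Measure.prod_restrict, lintegral_prod_symm]
  refine Measurable.aemeasurable (Measurable.mul (by fun_prop) (hf.comp (by fun_prop)))

theorem volume_polarRegion {R : ℝ} (hR : 0 ≤ R) {ψ : ℝ → ℝ} (hψ : Measurable ψ) :
    volume (polarRegion R ψ) =
      ∫⁻ θ in Set.Ioo (-Real.pi) Real.pi, ENNReal.ofReal (ψ (Real.cos θ) / 2) := by
  let T : Set (ℝ × ℝ) := {x | R ^ 2 < x.1 ^ 2 + x.2 ^ 2 ∧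
    x.1 ^ 2 + x.2 ^ 2 < R ^ 2 + ψ (x.1 / √(x.1 ^ 2 + x.2 ^ 2))}
  have hsq : Measurable fun x : ℝ × ℝ => x.1 ^ 2 + x.2 ^ 2 := by fun_prop
  have hT : MeasurableSet T :=
    (measurableSet_lt measurable_const hsq).inter (measurableSet_lt hsq
      (measurable_const.add (hψ.comp (measurable_fst.div (Real.continuous_sqrt.measurable.comp hsq)))))
  have hn : ∀ z : Plane, z 0 ^ 2 + z 1 ^ 2 = ‖z‖ ^ 2 := fun z => by
    rw [EuclideanSpace.real_norm_sq_eq, Fin.sum_univ_two]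
  have hpre : polarRegion R ψ = (fun z : Plane => (z 0, z 1)) ⁻¹' T := by
    ext z
    simp only [polarRegion, T, Set.mem_preimage, Set.mem_ofPred_eq, hn,
      Real.sqrt_sq (norm_nonneg z)]
  have he : Measurable fun z : Plane => (z 0, z 1) := by fun_prop
  rw [hpre, ← lintegral_indicator_one (he hT)]
  refine (lintegral_plane_eq_polar (f := T.indicator 1) (measurable_one.indicator hT)).trans ?_
  refine lintegral_congr fun θ => ?_
  have hin : ∀ ρ ∈ Set.Ioi (0 : ℝ), ENNReal.ofReal ρ * T.indicator 1 (ρ * Real.cos θ, ρ * Real.sin θ)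
      = (Set.Ioo R √(R ^ 2 + ψ (Real.cos θ))).indicator (fun ρ => ENNReal.ofReal ρ) ρ := by
    intro ρ hρ
    have hρ : 0 < ρ := hρ
    have h1 : (ρ * Real.cos θ) ^ 2 + (ρ * Real.sin θ) ^ 2 = ρ ^ 2 := by
      linear_combination ρ ^ 2 * Real.cos_sq_add_sin_sq θ
    have h2 : (ρ * Real.cos θ, ρ * Real.sin θ) ∈ T ↔ ρ ∈ Set.Ioo R √(R ^ 2 + ψ (Real.cos θ)) := by
      simp only [T, Set.mem_ofPred_eq, h1, Real.sqrt_sq hρ.le, mul_div_cancel_left₀ _ hρ.ne',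
        Set.mem_Ioo, sq_lt_sq₀ hR hρ.le, Real.lt_sqrt hρ.le]
    by_cases h : (ρ * Real.cos θ, ρ * Real.sin θ) ∈ T
    · rw [Set.indicator_of_mem h, Set.indicator_of_mem (h2.1 h), Pi.one_apply, mul_one]
    · rw [Set.indicator_of_notMem h, Set.indicator_of_notMem (fun h' => h (h2.2 h')), mul_zero]
  have hsub : Set.Ioo R √(R ^ 2 + ψ (Real.cos θ)) ⊆ Set.Ioi 0 := fun ρ hρ => hR.trans_lt hρ.1
  rw [setLIntegral_congr_fun measurableSet_Ioi hin, lintegral_indicator measurableSet_Ioo,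
    Measure.restrict_restrict measurableSet_Ioo, Set.inter_eq_left.2 hsub]
  rcases le_total (ψ (Real.cos θ)) 0 with h | h
  · rw [Set.Ioo_eq_empty (not_lt.2 ((Real.sqrt_le_left hR).2 (by linarith))),
      ENNReal.ofReal_of_nonpos (by linarith)]
    simp
  · rw [lintegral_ofReal_Ioo (Real.le_sqrt_of_sq_le (by linarith)) hR,
      Real.sq_sqrt (by positivity)]
    congr 1
    ring

theorem integral_comp_cos_symm {ψ : ℝ → ℝ} (hψ : Continuous ψ) :
    ∫ θ in (-Real.pi)..Real.pi, ψ (Real.cos θ) = 2 * ∫ θ in (0 : ℝ)..Real.pi, ψ (Real.cos θ) := by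
  have hc : Continuous fun θ => ψ (Real.cos θ) := hψ.comp Real.continuous_cos
  have h := intervalIntegral.integral_comp_neg (a := 0) (b := Real.pi) fun θ => ψ (Real.cos θ)
  simp only [Real.cos_neg, neg_zero] at h
  rw [← intervalIntegral.integral_add_adjacent_intervals (hc.intervalIntegrable _ 0)
    (hc.intervalIntegrable 0 _), ← h]
  ring

theorem integral_Ioo_comp_cos {ψ : ℝ → ℝ} (hψ : Continuous ψ) :
    ∫ θ in Set.Ioo (-Real.pi) Real.pi, ψ (Real.cos θ) / 2 =
      ∫ θ in (0 : ℝ)..Real.pi, ψ (Real.cos θ) := by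
  rw [← integral_Ioc_eq_integral_Ioo, ← intervalIntegral.integral_of_le (by linarith [Real.pi_pos]),
    intervalIntegral.integral_div, integral_comp_cos_symm hψ]
  ring

theorem integrableOn_comp_cos {ψ : ℝ → ℝ} (hψ : Continuous ψ) :
    IntegrableOn (fun θ => ψ (Real.cos θ) / 2) (Set.Ioo (-Real.pi) Real.pi) := by
  have hc : Continuous fun θ => ψ (Real.cos θ) / 2 := (hψ.comp Real.continuous_cos).div_const _
  exact (hc.integrableOn_Icc (a := -Real.pi) (b := Real.pi)).mono_set Set.Ioo_subset_Icc_self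

theorem volume_polarRegion_of_nonneg {R : ℝ} (hR : 0 ≤ R) {ψ : ℝ → ℝ} (hψ : Continuous ψ)
    (h0 : ∀ c, 0 ≤ ψ c) : volume (polarRegion R ψ) =
      ENNReal.ofReal (∫ θ in (0 : ℝ)..Real.pi, ψ (Real.cos θ)) := by
  rw [volume_polarRegion hR hψ.measurable, ← integral_Ioo_comp_cos hψ,
    ofReal_integral_eq_lintegral_ofReal (integrableOn_comp_cos hψ)
      (.of_forall fun θ => div_nonneg (h0 _) two_pos.le)]

theorem le_volume_polarRegion {R : ℝ} (hR : 0 ≤ R) {ψ : ℝ → ℝ} (hψ : Continuous ψ) :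
    ENNReal.ofReal (∫ θ in (0 : ℝ)..Real.pi, ψ (Real.cos θ)) ≤ volume (polarRegion R ψ) := by
  have hψ' : Continuous fun c => max (ψ c) 0 := hψ.max continuous_const
  calc ENNReal.ofReal (∫ θ in (0 : ℝ)..Real.pi, ψ (Real.cos θ))
      ≤ ENNReal.ofReal (∫ θ in (0 : ℝ)..Real.pi, max (ψ (Real.cos θ)) 0) := by
        refine ENNReal.ofReal_le_ofReal (intervalIntegral.integral_mono Real.pi_pos.le
          ((hψ.comp Real.continuous_cos).intervalIntegrable _ _)
          ((hψ'.comp Real.continuous_cos).intervalIntegrable _ _) fun θ => le_max_left _ _)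
    _ = volume (polarRegion R fun c => max (ψ c) 0) :=
        (volume_polarRegion_of_nonneg hR hψ' fun c => le_max_right _ _).symm
    _ ≤ volume (polarRegion R ψ) := by
        refine measure_mono fun z hz => ⟨hz.1, ?_⟩
        have h1 := hz.1
        rcases max_cases (ψ (z 0 / ‖z‖)) 0 with h | h
        · simpa only [h.1] using hz.2
        · have h2 := hz.2
          simp only [h.1] at h2
          linarith

end Polar

namespace Network

variable {ι : Type*} (N : Network ι)

theorem gap_eq (k j : ι) (p z v : Plane) : N.gap k j p z v = N.gap k j p z 0 +
    2 * inner ℝ v (p - N.beta k j • z) + (N.beta k j - 1) * ‖v‖ ^ 2 := by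
  simp only [gap, norm_sub_sq_real, inner_sub_right, inner_smul_right, inner_zero_left, norm_zero]
  ring

theorem IsNear.gap_le {k j : ι} {d : ℝ} {p z : Plane} (h : N.IsNear k j d p z) :
    N.gap k j p z 0 ≤ 2 * d * ‖p - N.beta k j • z‖ + |N.beta k j - 1| * d ^ 2 := by
  obtain ⟨v, hv, h⟩ := h
  rw [gap_eq] at h
  have h1 := (abs_le.1 (abs_real_inner_le_norm v (p - N.beta k j • z))).1
  have h2 : ‖v‖ * ‖p - N.beta k j • z‖ ≤ d * ‖p - N.beta k j • z‖ := by gcongr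
  have h3 : -((N.beta k j - 1) * ‖v‖ ^ 2) ≤ |N.beta k j - 1| * d ^ 2 := by
    rw [← neg_mul]
    gcongr
    exact neg_le_abs _
  linarith

theorem isNear_of_gap_lt {k j : ι} {d : ℝ} (hd : 0 < d) {p z : Plane} (h0 : 0 < N.gap k j p z 0)
    (h : N.gap k j p z 0 < 2 * d * ‖p - N.beta k j • z‖ - |N.beta k j - 1| * d ^ 2) :
    N.IsNear k j d p z := by
  set q := p - N.beta k j • z with hq
  have hq0 : 0 < ‖q‖ := by
    by_contra hn
    have : ‖q‖ = 0 := le_antisymm (not_lt.1 hn) (norm_nonneg _)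
    rw [this] at h
    have := mul_nonneg (abs_nonneg (N.beta k j - 1)) (sq_nonneg d)
    linarith
  have hgap : ∀ t : ℝ, N.gap k j p z (-(t / ‖q‖) • q) =
      N.gap k j p z 0 - 2 * t * ‖q‖ + (N.beta k j - 1) * t ^ 2 := by
    intro t
    rw [gap_eq, ← hq, real_inner_smul_left, real_inner_self_eq_norm_sq, norm_smul, Real.norm_eq_abs,
      mul_pow, sq_abs]
    field_simp
    ring
  have hcont : ContinuousOn (fun t : ℝ => N.gap k j p z 0 - 2 * t * ‖q‖ + (N.beta k j - 1) * t ^ 2)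
      (Set.Icc 0 d) := by fun_prop
  have hmem : (0 : ℝ) ∈ Set.Ioo (N.gap k j p z 0 - 2 * d * ‖q‖ + (N.beta k j - 1) * d ^ 2)
      (N.gap k j p z 0 - 2 * 0 * ‖q‖ + (N.beta k j - 1) * 0 ^ 2) := by
    have h1 : (N.beta k j - 1) * d ^ 2 ≤ |N.beta k j - 1| * d ^ 2 := by
      gcongr
      exact le_abs_self _
    exact ⟨by linarith, by simpa using h0⟩
  obtain ⟨t, ht, h1⟩ := intermediate_value_Ioo' hd.le hcont hmem
  refine ⟨-(t / ‖q‖) • q, ?_, (hgap t).trans h1⟩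
  rw [norm_smul, Real.norm_eq_abs, abs_neg, abs_of_nonneg (div_nonneg ht.1.le hq0.le),
    div_mul_cancel₀ _ hq0.ne']
  exact ht.2

/-- The distance within which no tier `j` station lies when the serving station is at distance
`r`. -/
noncomputable def exclusionRadius (k j : ι) (r : ℝ) : ℝ :=
  √((r ^ 2 + N.heightDiff k ^ 2) / N.beta k j - N.heightDiff j ^ 2)

/-- The length of `p - β z` for `‖p‖ = r`, `z` on the exclusion circle, as a function of the cosine
of the angle between them. -/
noncomputable def gradNorm (k j : ι) (r c : ℝ) : ℝ :=
  √(r ^ 2 + N.beta k j ^ 2 * N.exclusionRadius k j r ^ 2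
    - 2 * N.beta k j * r * c * N.exclusionRadius k j r)

theorem continuous_gradNorm (k j : ι) (r : ℝ) : Continuous (N.gradNorm k j r) := by
  unfold gradNorm
  fun_prop

theorem exclusionRadius_nonneg (k j : ι) (r : ℝ) : 0 ≤ N.exclusionRadius k j r :=
  Real.sqrt_nonneg _

theorem exclusionRadius_sq {k j : ι} {r : ℝ}
    (h : 0 ≤ (r ^ 2 + N.heightDiff k ^ 2) / N.beta k j - N.heightDiff j ^ 2) :
    N.exclusionRadius k j r ^ 2 = (r ^ 2 + N.heightDiff k ^ 2) / N.beta k j - N.heightDiff j ^ 2 :=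
  Real.sq_sqrt h

theorem vartheta_eq (k j : ι) {r : ℝ} (hr : 0 ≤ r)
    (h : 0 ≤ (r ^ 2 + N.heightDiff k ^ 2) / N.beta k j - N.heightDiff j ^ 2) :
    N.vartheta k j r =
      1 / N.beta k j * ∫ θ in (0 : ℝ)..Real.pi, N.gradNorm k j r (Real.cos θ) := by
  have hβ := N.beta_pos k j
  have hsq := N.exclusionRadius_sq h
  unfold vartheta
  split_ifs with hkj
  · subst hkj
    have hR : N.exclusionRadius k k r = r := by
      rw [exclusionRadius, beta_self, div_one, add_sub_cancel_right, Real.sqrt_sq hr]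
    rw [beta_self, div_one, one_mul, ← intervalIntegral.integral_const_mul]
    refine intervalIntegral.integral_congr fun θ _ => ?_
    simp only [gradNorm, hR, beta_self]
    rw [show r ^ 2 + 1 ^ 2 * r ^ 2 - 2 * 1 * r * Real.cos θ * r = r ^ 2 * (2 - 2 * Real.cos θ) by ring,
      Real.sqrt_mul (sq_nonneg r), Real.sqrt_sq hr]
  · congr 1
    refine intervalIntegral.integral_congr fun θ _ => ?_
    simp only [gradNorm, hsq]
    congr 1
    rw [exclusionRadius]
    field_simp
    ring

theorem vartheta_self (k : ι) (r : ℝ) : N.vartheta k k r = 4 * r := by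
  have h1 : ∫ θ in (0 : ℝ)..Real.pi, √(2 - 2 * Real.cos θ) =
      ∫ θ in (0 : ℝ)..Real.pi, 2 * Real.sin (θ / 2) := by
    refine intervalIntegral.integral_congr fun θ hθ => ?_
    rw [Set.uIcc_of_le Real.pi_pos.le] at hθ
    have h2 : 2 - 2 * Real.cos θ = (2 * Real.sin (θ / 2)) ^ 2 := by
      have := Real.cos_sq (θ / 2)
      rw [mul_pow, Real.sin_sq, this]
      ring_nf
    simp only [h2]
    refine Real.sqrt_sq (mul_nonneg two_pos.le (Real.sin_nonneg_of_nonneg_of_le_pi ?_ ?_))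
    · linarith [hθ.1]
    · linarith [hθ.2, Real.pi_pos]
  rw [vartheta, if_pos rfl, h1, intervalIntegral.integral_const_mul,
    intervalIntegral.integral_comp_div (fun x => Real.sin x) two_ne_zero, integral_sin]
  simp
  ring

theorem gap_axisPoint {k j : ι} {r : ℝ}
    (h : 0 ≤ (r ^ 2 + N.heightDiff k ^ 2) / N.beta k j - N.heightDiff j ^ 2) (z : Plane) :
    N.gap k j (axisPoint r) z 0 = N.beta k j * (‖z‖ ^ 2 - N.exclusionRadius k j r ^ 2) := by
  have hβ := N.beta_pos k j
  rw [exclusionRadius_sq N h, gap, zero_sub, zero_sub, norm_neg, norm_neg, norm_axisPoint, sq_abs]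
  field_simp
  ring

theorem gradNorm_eq (k j : ι) (r : ℝ) {z : Plane} (hz : z ≠ 0) :
    N.gradNorm k j r (z 0 / ‖z‖) =
      ‖axisPoint r - (N.beta k j * (N.exclusionRadius k j r / ‖z‖)) • z‖ := by
  have hz' : ‖z‖ ≠ 0 := norm_ne_zero_iff.2 hz
  rw [gradNorm, ← Real.sqrt_sq (norm_nonneg (axisPoint r - _)), norm_sub_sq_real, norm_axisPoint,
    sq_abs, inner_smul_right, norm_smul, mul_pow, Real.norm_eq_abs, sq_abs]
  have : inner ℝ (axisPoint r) z = r * z 0 := by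
    simp [axisPoint, EuclideanSpace.inner_single_left]
  rw [this]
  congr 1
  field_simp
  ring

theorem abs_norm_sub_gradNorm_le (k j : ι) {r : ℝ} {z : Plane}
    (hz : N.exclusionRadius k j r < ‖z‖) :
    |‖axisPoint r - N.beta k j • z‖ - N.gradNorm k j r (z 0 / ‖z‖)| ≤
      N.beta k j * (‖z‖ - N.exclusionRadius k j r) := by
  have hR := N.exclusionRadius_nonneg k j r
  have hz0 : 0 < ‖z‖ := hR.trans_lt hz
  have hβ := N.beta_pos k j
  rw [gradNorm_eq N k j r (norm_pos_iff.1 hz0)]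
  refine (abs_norm_sub_norm_le _ _).trans_eq ?_
  rw [sub_sub_sub_cancel_left, ← sub_smul, norm_smul, Real.norm_eq_abs, ← abs_norm z, ← abs_mul,
    abs_norm, show (N.beta k j * (N.exclusionRadius k j r / ‖z‖) - N.beta k j) * ‖z‖ =
      -(N.beta k j * (‖z‖ - N.exclusionRadius k j r)) by field_simp; ring, abs_neg,
    abs_of_pos (mul_pos hβ (sub_pos.2 hz))]

/-- The constant of the quadratic error term of the area of the near region. -/
noncomputable def errorConst (k j : ι) (r : ℝ) : ℝ :=
  2 * (2 * (r / N.exclusionRadius k j r + N.beta k j) +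
    |N.beta k j - 1| / N.exclusionRadius k j r) + |N.beta k j - 1|

theorem nearRegion_subset_polarRegion {k j : ι} {r d : ℝ} (hr : 0 ≤ r)
    (h : 0 < (r ^ 2 + N.heightDiff k ^ 2) / N.beta k j - N.heightDiff j ^ 2)
    (hd : 0 < d) (hd1 : d ≤ 1) : N.nearRegion k j d (axisPoint r) ⊆
      polarRegion (N.exclusionRadius k j r) fun c =>
        (2 * d * N.gradNorm k j r c + (N.errorConst k j r + 1) * d ^ 2) / N.beta k j := by
  rintro z ⟨h0, hz⟩
  have hR : 0 < N.exclusionRadius k j r := Real.sqrt_pos.2 h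
  have hβ := N.beta_pos k j
  have hle := IsNear.gap_le N hz
  rw [gap_axisPoint N h.le] at h0 hle
  have hsq := sub_pos.1 (pos_of_mul_pos_right h0 hβ.le)
  have hRz := (sq_lt_sq₀ hR.le (norm_nonneg z)).1 hsq
  refine ⟨hsq, ?_⟩
  have habs := (abs_le.1 (N.abs_norm_sub_gradNorm_le k j hRz)).2
  have hnorm : ‖axisPoint r - N.beta k j • z‖ ≤ r + N.beta k j * ‖z‖ := by
    refine (norm_sub_le _ _).trans_eq ?_
    rw [norm_axisPoint, norm_smul, abs_of_nonneg hr, Real.norm_eq_abs, abs_of_pos hβ]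
  rw [← sub_lt_iff_lt_add', lt_div_iff₀ hβ, errorConst]
  set R := N.exclusionRadius k j r
  set m := ‖z‖
  set b := N.beta k j
  set e := |b - 1|
  set n := ‖axisPoint r - b • z‖
  set g := N.gradNorm k j r (z 0 / m)
  have he : 0 ≤ e := abs_nonneg _
  have hlin : b * (m - R) ≤ (2 * (r / R + b) + e / R) * d := by
    have h1 : b * (m - R) * (m + R) ≤ (2 * (r / R + b) + e / R) * d * (m + R) := by
      have h2 : 2 * d * n + e * d ^ 2 ≤ (2 * (r + b * m) + e) * d := by
        nlinarith [mul_le_mul_of_nonneg_left hnorm hd.le, mul_nonneg he hd.le,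
          mul_nonneg (mul_nonneg he hd.le) (sub_nonneg.2 hd1)]
      have h3 : 2 * (r + b * m) + e ≤ (2 * (r / R + b) + e / R) * (m + R) := by
        have h4 : r ≤ r / R * (m + R) := by
          rw [mul_add, div_mul_cancel₀ _ hR.ne']
          exact le_add_of_nonneg_left (mul_nonneg (div_nonneg hr hR.le) (norm_nonneg z))
        have h5 : e ≤ e / R * (m + R) := by
          rw [mul_add, div_mul_cancel₀ _ hR.ne']
          exact le_add_of_nonneg_left (mul_nonneg (div_nonneg he hR.le) (norm_nonneg z))
        nlinarith [mul_pos hβ hR]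
      nlinarith [mul_le_mul_of_nonneg_right h3 hd.le]
    exact le_of_mul_le_mul_right h1 (by linarith [norm_nonneg z])
  have h6 : d * n ≤ d * (g + (2 * (r / R + b) + e / R) * d) :=
    mul_le_mul_of_nonneg_left (by linarith) hd.le
  nlinarith [pow_pos hd 2]

/-- The coefficient of the bound for the gap in the lower estimate. -/
noncomputable def gapCoeff (k j : ι) (r : ℝ) : ℝ := 2 * (r + N.beta k j * N.exclusionRadius k j r)

theorem polarRegion_subset_nearRegion {k j : ι} {r d : ℝ} (hr : 0 ≤ r)
    (h : 0 < (r ^ 2 + N.heightDiff k ^ 2) / N.beta k j - N.heightDiff j ^ 2) (hd : 0 < d) :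
    (polarRegion (N.exclusionRadius k j r) fun c =>
        (2 * d * N.gradNorm k j r c - N.errorConst k j r * d ^ 2) / N.beta k j) ⊆
      N.nearRegion k j d (axisPoint r) ∩ N.thinRegion k j (N.gapCoeff k j r * d) (axisPoint r) := by
  rintro z ⟨hsq, hz⟩
  have hR : 0 < N.exclusionRadius k j r := Real.sqrt_pos.2 h
  have hβ := N.beta_pos k j
  have hRz := (sq_lt_sq₀ hR.le (norm_nonneg z)).1 hsq
  have habs := (abs_le.1 (N.abs_norm_sub_gradNorm_le k j hRz)).1
  have h0 : 0 < N.gap k j (axisPoint r) z 0 := by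
    rw [gap_axisPoint N h.le]
    exact mul_pos hβ (sub_pos.2 hsq)
  have hgrad : N.gradNorm k j r (z 0 / ‖z‖) ≤ r + N.beta k j * N.exclusionRadius k j r := by
    have hz0 : 0 < ‖z‖ := hR.trans hRz
    rw [gradNorm_eq N k j r (norm_pos_iff.1 hz0)]
    refine (norm_sub_le _ _).trans_eq ?_
    rw [norm_axisPoint, abs_of_nonneg hr, norm_smul, Real.norm_eq_abs,
      abs_of_nonneg (by positivity)]
    field_simp
  rw [← sub_lt_iff_lt_add', lt_div_iff₀ hβ, errorConst] at hz
  have hgapeq := gap_axisPoint N h.le z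
  suffices hs : N.gap k j (axisPoint r) z 0 <
      2 * d * ‖axisPoint r - N.beta k j • z‖ - |N.beta k j - 1| * d ^ 2 ∧
      N.gap k j (axisPoint r) z 0 < N.gapCoeff k j r * d from
    ⟨⟨h0, N.isNear_of_gap_lt hd h0 hs.1⟩, h0, hs.2⟩
  rw [hgapeq] at h0 ⊢
  rw [gapCoeff]
  set R := N.exclusionRadius k j r
  set m := ‖z‖
  set b := N.beta k j
  set e := |b - 1|
  set n := ‖axisPoint r - b • z‖
  set g := N.gradNorm k j r (z 0 / m)
  have he : 0 ≤ e := abs_nonneg _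
  have he' : 0 ≤ e / R := div_nonneg he hR.le
  have hr' : 0 ≤ r / R := div_nonneg hr hR.le
  have hd2 := pow_pos hd 2
  have hE : 0 ≤ (2 * (2 * (r / R + b) + e / R) + e) * d ^ 2 := by positivity
  have h1 : b * (m ^ 2 - R ^ 2) < 2 * (r + b * R) * d := by
    nlinarith [mul_le_mul_of_nonneg_left hgrad hd.le]
  have hlin : b * (m - R) ≤ (2 * (r / R + b) + e / R) * d := by
    have h2 : b * (m - R) * R ≤ (2 * (r / R + b) + e / R) * d * R := by
      have h3 : (2 * (r / R + b) + e / R) * d * R = (2 * (r + b * R) + e) * d := by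
        field_simp
      rw [h3]
      nlinarith [mul_nonneg he hd.le, mul_pos hβ (sub_pos.2 hRz), norm_nonneg z,
        mul_nonneg (mul_pos hβ (sub_pos.2 hRz)).le (norm_nonneg z)]
    exact le_of_mul_le_mul_right h2 hR
  have h6 : d * (g - (2 * (r / R + b) + e / R) * d) ≤ d * n :=
    mul_le_mul_of_nonneg_left (by linarith) hd.le
  exact ⟨by nlinarith, h1⟩

theorem thinRegion_eq_polarRegion {k j : ι} {r : ℝ}
    (h : 0 ≤ (r ^ 2 + N.heightDiff k ^ 2) / N.beta k j - N.heightDiff j ^ 2) (c : ℝ) :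
    N.thinRegion k j c (axisPoint r) =
      polarRegion (N.exclusionRadius k j r) fun _ => c / N.beta k j := by
  have hβ := N.beta_pos k j
  ext z
  simp only [thinRegion, polarRegion, Set.mem_ofPred_eq, gap_axisPoint N h]
  rw [mul_pos_iff_of_pos_left hβ, sub_pos, ← sub_lt_iff_lt_add', lt_div_iff₀' hβ]

theorem integral_gradNorm (k j : ι) {r : ℝ} (hr : 0 ≤ r)
    (h : 0 ≤ (r ^ 2 + N.heightDiff k ^ 2) / N.beta k j - N.heightDiff j ^ 2) (d c : ℝ) :
    ∫ θ in (0 : ℝ)..Real.pi, (2 * d * N.gradNorm k j r (Real.cos θ) + c * d ^ 2) / N.beta k j =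
      2 * d * N.vartheta k j r + Real.pi * c / N.beta k j * d ^ 2 := by
  have hc : Continuous fun θ => N.gradNorm k j r (Real.cos θ) :=
    (N.continuous_gradNorm k j r).comp Real.continuous_cos
  rw [intervalIntegral.integral_div, intervalIntegral.integral_add
    ((hc.const_mul _).intervalIntegrable _ _) (continuous_const.intervalIntegrable _ _),
    intervalIntegral.integral_const_mul, intervalIntegral.integral_const, vartheta_eq N k j hr h,
    smul_eq_mul]
  ring

theorem errorConst_nonneg (k j : ι) {r : ℝ} (hr : 0 ≤ r) : 0 ≤ N.errorConst k j r := by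
  have hR := N.exclusionRadius_nonneg k j r
  have hβ := N.beta_pos k j
  unfold errorConst
  positivity

theorem vartheta_nonneg (k j : ι) {r : ℝ} (hr : 0 ≤ r)
    (h : 0 ≤ (r ^ 2 + N.heightDiff k ^ 2) / N.beta k j - N.heightDiff j ^ 2) :
    0 ≤ N.vartheta k j r := by
  rw [vartheta_eq N k j hr h]
  exact mul_nonneg (one_div_nonneg.2 (N.beta_pos k j).le)
    (intervalIntegral.integral_nonneg Real.pi_pos.le fun θ _ => Real.sqrt_nonneg _)

theorem upperBound_le {k j : ι} {r d : ℝ} (hr : 0 ≤ r)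
    (h : 0 < (r ^ 2 + N.heightDiff k ^ 2) / N.beta k j - N.heightDiff j ^ 2)
    (hd : 0 < d) (hd1 : d ≤ 1) : N.upperBound k j d r ≤ ENNReal.ofReal (N.lam j *
      (2 * d * N.vartheta k j r + Real.pi * (N.errorConst k j r + 1) / N.beta k j * d ^ 2)) := by
  have hβ := N.beta_pos k j
  have hE := N.errorConst_nonneg k j hr
  rw [upperBound, ENNReal.ofReal_mul (N.lam_pos j).le, ← integral_gradNorm N k j hr h.le]
  gcongr
  refine (measure_mono (N.nearRegion_subset_polarRegion hr h hd hd1)).trans_eq ?_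
  refine volume_polarRegion_of_nonneg (N.exclusionRadius_nonneg k j r) ?_ fun c => ?_
  · have := N.continuous_gradNorm k j r
    fun_prop
  · have : 0 ≤ N.gradNorm k j r c := Real.sqrt_nonneg _
    positivity

theorem le_lowerBound {k j : ι} {r d : ℝ} (hr : 0 ≤ r)
    (h : 0 < (r ^ 2 + N.heightDiff k ^ 2) / N.beta k j - N.heightDiff j ^ 2) (hd : 0 < d) :
    ENNReal.ofReal (N.lam j * (2 * d * N.vartheta k j r -
        (Real.pi * N.errorConst k j r / N.beta k j + 2 * N.vartheta k j r *
          (N.lam j * (Real.pi * N.gapCoeff k j r / N.beta k j))) * d ^ 2)) ≤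
      N.lowerBound k j (fun r => N.gapCoeff k j r * d) d r := by
  have hβ := N.beta_pos k j
  have hl := N.lam_pos j
  have hE := N.errorConst_nonneg k j hr
  have hϑ := N.vartheta_nonneg k j hr h.le
  have hG : 0 ≤ N.gapCoeff k j r := by
    have := N.exclusionRadius_nonneg k j r
    unfold gapCoeff
    positivity
  have hthin : (volume (N.thinRegion k j (N.gapCoeff k j r * d) (axisPoint r))).toReal =
      Real.pi * N.gapCoeff k j r / N.beta k j * d := by
    rw [thinRegion_eq_polarRegion N h.le, volume_polarRegion_of_nonneg (N.exclusionRadius_nonneg k j r)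
      continuous_const fun _ => by positivity, intervalIntegral.integral_const,
      ENNReal.toReal_ofReal]
    · simp only [sub_zero, smul_eq_mul]
      ring
    · have := Real.pi_pos
      simp only [sub_zero, smul_eq_mul]
      positivity
  set x := 2 * d * N.vartheta k j r - Real.pi * N.errorConst k j r / N.beta k j * d ^ 2 with hx
  have hvol : ENNReal.ofReal x ≤ volume (N.nearRegion k j d (axisPoint r) ∩
      N.thinRegion k j (N.gapCoeff k j r * d) (axisPoint r)) := by
    refine le_trans ?_ (measure_mono (N.polarRegion_subset_nearRegion hr h hd))
    have hcont : Continuous fun c =>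
        (2 * d * N.gradNorm k j r c - N.errorConst k j r * d ^ 2) / N.beta k j := by
      have := N.continuous_gradNorm k j r
      fun_prop
    refine le_trans (le_of_eq ?_) (le_volume_polarRegion (N.exclusionRadius_nonneg k j r) hcont)
    have := integral_gradNorm N k j hr h.le d (-N.errorConst k j r)
    simp only [neg_mul, ← sub_eq_add_neg] at this
    rw [this, hx]
    congr 1
    ring
  rw [lowerBound, hthin]
  refine le_trans ?_ (mul_le_mul_left (mul_le_mul_right hvol _) _)
  rw [← ENNReal.ofReal_mul hl.le]
  set y := N.lam j * (Real.pi * N.gapCoeff k j r / N.beta k j * d) with hy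
  have hy0 : 0 ≤ y := by
    have := Real.pi_pos
    positivity
  rcases le_total 0 x with hx0 | hx0
  · rw [← ENNReal.ofReal_mul (by positivity), mul_assoc (N.lam j) x]
    refine ENNReal.ofReal_le_ofReal (mul_le_mul_of_nonneg_left ?_ hl.le)
    have h1 : x * (1 - y) ≤ x * Real.exp (-y) :=
      mul_le_mul_of_nonneg_left (by linarith [Real.add_one_le_exp (-y)]) hx0
    have h2 : x * y ≤ 2 * d * N.vartheta k j r * y := by
      refine mul_le_mul_of_nonneg_right ?_ hy0
      have : 0 ≤ Real.pi * N.errorConst k j r / N.beta k j * d ^ 2 := by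
        have := Real.pi_pos
        positivity
      linarith
    refine le_trans (le_of_eq ?_) (le_trans (by linarith : x - 2 * d * N.vartheta k j r * y ≤ _) h1)
    rw [hx, hy]
    ring
  · rw [ENNReal.ofReal_of_nonpos]
    · exact zero_le
    · refine mul_nonpos_of_nonneg_of_nonpos hl.le (le_trans ?_ hx0)
      have : 0 ≤ 2 * d * N.vartheta k j r * y := by positivity
      refine le_trans (le_of_eq ?_) (by linarith : x - 2 * d * N.vartheta k j r * y ≤ x)
      rw [hx, hy]
      ring

end Network

/-- A monotone function with a linear expansion along the rationals has the same expansion along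
the reals. -/
theorem isBigO_sq_of_forall_rat {f : ℝ → ℝ} (hf : Monotone f) {a M : ℝ} (ha : 0 ≤ a)
    (hM : 0 ≤ M) (h : ∀ q : ℚ, 0 < (q : ℝ) → (q : ℝ) ≤ 1 → |f q - a * q| ≤ M * (q : ℝ) ^ 2) :
    (fun d => f d - a * d) =O[𝓝[>] 0] fun d : ℝ => d ^ 2 := by
  refine IsBigO.of_bound (a + 4 * M) ?_
  have hev : ∀ᶠ d : ℝ in 𝓝[>] 0, d ∈ Set.Ioo (0 : ℝ) (1 / 2) :=
    Ioo_mem_nhdsGT (by norm_num)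
  filter_upwards [hev] with d ⟨hd0, hd1⟩
  have hd2 : 0 < d ^ 2 := by positivity
  have hdd : d ^ 2 < d := by nlinarith
  obtain ⟨q, hq1, hq2⟩ := exists_rat_btwn (show d < d + d ^ 2 by linarith)
  obtain ⟨s, hs1, hs2⟩ := exists_rat_btwn (show d - d ^ 2 < d by linarith)
  have hq := (abs_le.1 (h q (by linarith) (by linarith))).2
  have hs := (abs_le.1 (h s (by linarith) (by linarith))).1
  have hfq := hf hq1.le
  have hfs := hf hs2.le
  have hqq : (q : ℝ) ^ 2 ≤ 4 * d ^ 2 := by nlinarith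
  have hss : (s : ℝ) ^ 2 ≤ d ^ 2 := by nlinarith
  rw [Real.norm_eq_abs, Real.norm_eq_abs, abs_of_pos hd2, abs_le]
  constructor <;> nlinarith [mul_le_mul_of_nonneg_left hqq hM, mul_le_mul_of_nonneg_left hss hM,
    mul_le_mul_of_nonneg_left hq2.le ha, mul_le_mul_of_nonneg_left hs1.le ha, mul_nonneg hM hd2.le]

namespace Network

variable {ι : Type*} (N : Network ι)

theorem measurable_exclusionRadius (k j : ι) : Measurable (N.exclusionRadius k j) := by
  unfold exclusionRadius
  fun_prop

theorem monotone_condProb {Ω : Type*} [MeasurableSpace Ω] (Φ : ι → Ω → Config) (μ : Measure Ω)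
    [IsFiniteMeasure μ] (k j : ι) (r : ℝ) : Monotone (N.condProb Φ μ k j r) :=
  fun _ _ h => measureReal_mono (Set.Iio_subset_Iio (ENNReal.ofReal_le_ofReal h))

theorem ae_isBigO_condProb [Fintype ι] {Ω : Type*} [MeasurableSpace Ω] {Φ : ι → Ω → Config}
    {μ : Measure Ω} [IsProbabilityMeasure μ] (hΦ : ∀ i, IsPoissonProcess (Φ i) (N.lam i) μ)
    (hindep : iIndepFun Φ μ) (k j : ι) : ∀ᵐ r ∂N.distLaw Φ μ k,
      0 ≤ (r ^ 2 + N.heightDiff k ^ 2) / N.beta k j - N.heightDiff j ^ 2 →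
        (fun d : ℝ => N.condProb Φ μ k j r d - 2 * N.lam j * d * N.vartheta k j r)
          =O[𝓝[>] 0] (fun d : ℝ => d ^ 2) := by
  have hc : ∀ d : ℝ, Measurable fun r => N.gapCoeff k j r * d := fun d => by
    have := N.measurable_exclusionRadius k j
    unfold gapCoeff
    fun_prop
  filter_upwards [N.ae_nonneg_distLaw hΦ hindep k, N.ae_ne_zero_distLaw hΦ hindep k j,
    ae_all_iff.2 fun q : ℚ => N.condDistrib_le_upperBound hΦ hindep k j q,
    ae_all_iff.2 fun q : ℚ => N.lowerBound_le_condDistrib hΦ hindep k j (hc q) q]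
    with r hr hne hup hlow h0
  have h := lt_of_le_of_ne h0 hne.symm
  have hβ := N.beta_pos k j
  have hl := N.lam_pos j
  have hπ := Real.pi_pos
  have hE := N.errorConst_nonneg k j hr
  have hϑ := N.vartheta_nonneg k j hr h0
  have hG : 0 ≤ N.gapCoeff k j r := by
    have := N.exclusionRadius_nonneg k j r
    unfold gapCoeff
    positivity
  set M₁ := Real.pi * (N.errorConst k j r + 1) / N.beta k j with hM₁
  set M₂ := Real.pi * N.errorConst k j r / N.beta k j + 2 * N.vartheta k j r *
          (N.lam j * (Real.pi * N.gapCoeff k j r / N.beta k j)) with hM₂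
  have h1 : 0 ≤ M₁ := by positivity
  have h2 : 0 ≤ M₂ := by positivity
  have key := isBigO_sq_of_forall_rat (N.monotone_condProb Φ μ k j r)
    (a := 2 * N.lam j * N.vartheta k j r) (M := N.lam j * (M₁ + M₂)) (by positivity) (by positivity)
    fun q hq0 hq1 => ?_
  · refine key.congr_left fun d => ?_
    ring
  have hu := (hup q).trans (N.upperBound_le hr h hq0 hq1)
  have hv := (N.le_lowerBound hr h hq0).trans (hlow q)
  have hq2 := sq_nonneg (q : ℝ)
  have hu' : N.condProb Φ μ k j r q ≤
      N.lam j * (2 * q * N.vartheta k j r + M₁ * (q : ℝ) ^ 2) :=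
    ENNReal.toReal_le_of_le_ofReal (by positivity) hu
  have hv' : N.lam j * (2 * q * N.vartheta k j r - M₂ * (q : ℝ) ^ 2) ≤ N.condProb Φ μ k j r q :=
    (ENNReal.ofReal_le_iff_le_toReal (measure_ne_top _ _)).1 hv
  have h3 : 0 ≤ N.lam j * M₁ * (q : ℝ) ^ 2 := by positivity
  have h4 : 0 ≤ N.lam j * M₂ * (q : ℝ) ^ 2 := by positivity
  rw [abs_le]
  constructor <;> linarith

end Network

end Cellular

open Cellular in
theorem lemma3 {ι : Type*} [Fintype ι] (N : Network ι)
    {Ω : Type*} [MeasurableSpace Ω] (μ : Measure Ω) [IsProbabilityMeasure μ]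
    (Φ : ι → Ω → Config)
    (hΦ : ∀ i, IsPoissonProcess (Φ i) (N.lam i) μ)
    (hindep : iIndepFun Φ μ) (k j : ι) :
    -- the conditional probabilities are well defined
    0 < μ {ω | N.IsAssociated (fun i => Φ i ω) k} ∧
    NullMeasurableSet {ω | N.IsAssociated (fun i => Φ i ω) k} μ ∧
    AEMeasurable (fun ω => N.serviceDist (fun i => Φ i ω) k) (N.assocMeasure Φ μ k) ∧
    AEMeasurable (fun ω => N.boundaryDist (fun i => Φ i ω) k j) (N.assocMeasure Φ μ k) ∧
    -- the expansion, for almost every value `r` of the service distance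
    (∀ᵐ r ∂((N.assocMeasure Φ μ k).map (fun ω => N.serviceDist (fun i => Φ i ω) k)),
      0 ≤ (r ^ 2 + N.heightDiff k ^ 2) / N.beta k j - N.heightDiff j ^ 2 →
        (fun d : ℝ => N.condProb Φ μ k j r d - 2 * N.lam j * d * N.vartheta k j r)
          =O[𝓝[>] 0] (fun d : ℝ => d ^ 2)) ∧
    (k = j → ∀ r : ℝ, N.vartheta k j r = 4 * r) := by
  refine ⟨N.measure_isAssociated_pos hΦ hindep k,
    (N.measurableSet_isAssociated_configs hΦ k).nullMeasurableSet,
    (N.measurable_serviceDist_configs hΦ k).aemeasurable,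
    (N.measurable_boundaryDist_configs hΦ k j).aemeasurable,
    N.ae_isBigO_condProb hΦ hindep k j, ?_⟩
  rintro rfl r
  exact N.vartheta_self k r
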